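/- **Setting.** Let $m\ge 2$ be even. Let $G'_\infty=R(G(m,1,\infty))$ be the (discrete) group generated by $z_1,z_2,z_3$, $r_i$ $(i\ge1)$ and $\widehat\eta_j$ $(j\ge 1)$ with the defining relations: each $z_k$ is central with $z_k^2=e$; $r_i^2=e$, $(r_ir_{i+1})^3=e$, $r_ir_j=z_1r_jr_i$ for $|i-j|\ge2$; $\widehat\eta_j^{\,m}=e$, $\widehat\eta_j\widehat\eta_k=z_2\widehat\eta_k\widehat\eta_j$ for $j\ne k$; $r_i\widehat\eta_jr_i^{-1}=z_3\widehat\eta_{s_i(j)}$ for all $i,j$, where $s_i=(i\;\,i{+}1)$. Put $Z=\langle z_1,z_2,z_3\rangle\cong(\mathbb Z/2)^3$. Let $G_\infty=G(m,1,\infty)=D_\infty\rtimes\mathfrak S_\infty$, where $\mathfrak S_\infty$ is the group of finitary permutations of $\mathbb N$ and $D_\infty$ is the group of finitely supported sequences in $\mathbb Z/m$, permuted by $\mathfrak S_\infty$; let $y_j$ be the standard generator of the $j$-th copy of $\mathbb Z/m$, and let $\Phi:G'_\infty\to G_\infty$ be the homomorphism with $z_k\mapsto e$, $r_i\mapsto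 s_i$, $\widehat\eta_j\mapsto y_j$. For $g'\in G'_\infty$ with $\Phi(g')=(d,\sigma)$ put $\mathrm{supp}(g')=\{j: d_j\ne e\}\cup\{j:\sigma(j)\ne j\}$. For a discrete group $G$ let $K_1(G)$ be the convex set of central positive-definite functions $f:G\to\mathbb C$ with $f(e)=1$, and let $E(G)$, the set of (normalized) characters of $G$, be the set of extremal points of $K_1(G)$. A function $f\in K_1(G'_\infty)$ is *factorisable* if $f(h'k')=f(h')f(k')$ whenever $\mathrm{supp}(h')\cap\mathrm{supp}(k')=\varnothing$; $F(G'_\infty)$ is the set of all such $f$. For $\chi\in\widehat Z$, $E(G'_\infty;\chi)$ and $F(G'_\infty;\chi)$ consist of the $f$ in $E(G'_\infty)$, respectively $F(G'_\infty)$, of spin type $\chi$, that is, with $f(zg')=\chi(z)f(g')$ for all $z\in Z$, $g'\in G'_\infty$. The eight elements $\chi^{\rm Y}$ of $\widehat Z$, given by $(\chi^{\rm Y}(z_1),\chi^{\rm Y}(z_2),\chi^{\rm Y}(z_3))$, are $\chi^{\rm I}=(-1,-1,-1)$, $\chi^{\rm II}=(-1,-1,1)$, $\chi^{\rm III}=(-1,1,-1)$,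 $\chi^{\rm IV}=(-1,1,1)$, $\chi^{\rm V}=(1,-1,-1)$, $\chi^{\rm VI}=(1,-1,1)$, $\chi^{\rm VII}=(1,1,-1)$, $\chi^{\rm VIII}=(1,1,1)$. The spin types I, IV, V, VI, VIII are *of the first kind*, and II, III, VII are of the second kind. **Theorem 12.8.** (i) If $f_1,f_2\in F(G'_\infty)$, then the pointwise product $f_1f_2$ is a character of $G'_\infty$ and is again factorisable; in particular $F(G'_\infty)F(G'_\infty)\subset F(G'_\infty)$. Let ${\rm Y}_1,{\rm Y}_2,{\rm Y}_3$ be such that $\chi^{{\rm Y}_3}=\chi^{{\rm Y}_1}\chi^{{\rm Y}_2}$. Then $F(G'_\infty;\chi^{{\rm Y}_1})\cdot F(G'_\infty;\chi^{{\rm Y}_2})\subset F(G'_\infty;\chi^{{\rm Y}_3})$. If moreover $\chi^{{\rm Y}_1}$ and $\chi^{{\rm Y}_2}$ are both of the first kind, then $$E(G'_\infty;\chi^{{\rm Y}_1})\cdot E(G'_\infty;\chi^{{\rm Y}_2})\subset E(G'_\infty;\chi^{{\rm Y}_3}).\qquad(*)$$ (ii) Let $\chi^{{\rm Y}_3}=\chi^{{\rm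 Y}_1}\chi^{{\rm Y}_2}$ and assume that at least one of ${\rm Y}_1,{\rm Y}_2,{\rm Y}_3$ is ${\rm V}$ or ${\rm VI}$. Then $(*)$ holds. -/

import Mathlib

namespace SpinChar

/-! ### The group `G'_∞ = R(G(m,1,∞))`, `m` even -/

/-- Generators of the representation group `G'_∞`. Indices start at `0`:
`z 0, z 1, z 2` are `z₁, z₂, z₃`; `r i` lies over the transposition of `i` and `i + 1`;
`eta j` is the element `η̂_j` that lies over the generator `y_j` of the `j`-th copy of `ℤ/m`. -/
inductive Gen : Type
  | z (k : Fin 3) : Gen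
  | r (i : ℕ) : Gen
  | eta (j : ℕ) : Gen

open FreeGroup in
/-- The defining relators of
`G'_∞ = (D̃_∞ × Z₃) ⋊ S̃_∞`: the `z_k` are central involutions; the `r_i` satisfy Schur's relations
`r_i² = 1`, `(r_i r_{i+1})³ = 1`, `r_i r_j = z₁ r_j r_i` (`|i - j| ≥ 2`) of the covering group `S̃_∞`;
the `η̂_j` satisfy `η̂_j^m = 1`, `η̂_j η̂_k = z₂ η̂_k η̂_j` (`j ≠ k`); and
`r_i η̂_j r_i⁻¹ = z₃ η̂_{s_i j}` for all `i, j`, with `s_i = (i i+1)`. -/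
inductive Relator (m : ℕ) : FreeGroup Gen → Prop
  | z_sq (k : Fin 3) : Relator m (of (Gen.z k) ^ 2)
  | z_central (k : Fin 3) (x : Gen) : Relator m
      (of (Gen.z k) * of x * (of x * of (Gen.z k))⁻¹)
  | r_sq (i : ℕ) : Relator m (of (Gen.r i) ^ 2)
  | r_braid (i : ℕ) : Relator m ((of (Gen.r i) * of (Gen.r (i + 1))) ^ 3)
  | r_comm (i j : ℕ) (h : i + 2 ≤ j) : Relator m
      (of (Gen.r i) * of (Gen.r j) * (of (Gen.z 0) * of (Gen.r j) * of (Gen.r i))⁻¹)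
  | eta_pow (j : ℕ) : Relator m (of (Gen.eta j) ^ m)
  | eta_comm (j k : ℕ) (h : j ≠ k) : Relator m
      (of (Gen.eta j) * of (Gen.eta k) * (of (Gen.z 1) * of (Gen.eta k) * of (Gen.eta j))⁻¹)
  | r_eta (i j : ℕ) : Relator m
      (of (Gen.r i) * of (Gen.eta j) * (of (Gen.r i))⁻¹ *
        (of (Gen.z 2) * of (Gen.eta (Equiv.swap i (i + 1) j)))⁻¹)

/-- The representation group `G'_∞ = R(G(m,1,∞))` for even `m`, with the discrete topology
(the inductive limit topology of the finite groups `R(G(m,1,n))`). -/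
abbrev GInf' (m : ℕ) : Type := PresentedGroup {w : FreeGroup Gen | Relator m w}

/-- The central elements `z₁, z₂, z₃` of `G'_∞` (as `zc 0, zc 1, zc 2`). -/
def zc (m : ℕ) (k : Fin 3) : GInf' m := PresentedGroup.of (Gen.z k)

/-- The full monomial group `(ℤ/m)^ℕ ⋊ Sym(ℕ)`, where `σ` acts by `(σ d)_j = d_{σ⁻¹ j}`. It contains
`G_∞ = G(m,1,∞) = D_∞ ⋊ S_∞` as the subgroup of the elements `(d, σ)` for which `d` and `σ`
have finite support; that subgroup is generated by the `y_j` and the `s_i`. -/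
abbrev Mono (m : ℕ) : Type :=
  (ℕ → Multiplicative (ZMod m)) ⋊[mulAutArrow] Equiv.Perm ℕ

/-- The images of the generators under `Φ`: `z_k ↦ 1`, `r_i ↦ s_i = (i i+1)`, `η̂_j ↦ y_j`. -/
def genImage (m : ℕ) : Gen → Mono m
  | Gen.z _ => 1
  | Gen.r i => SemidirectProduct.inr (Equiv.swap i (i + 1))
  | Gen.eta j => SemidirectProduct.inl (Pi.mulSingle j (Multiplicative.ofAdd 1))

theorem genImage_relator (m : ℕ) (w : FreeGroup Gen) (hw : w ∈ {w | Relator m w}) :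
    FreeGroup.lift (genImage m) w = 1 := by
  have hw' : Relator m w := hw
  induction hw' with
  | z_sq k => simp [genImage]
  | z_central k x => simp [genImage]
  | r_sq i =>
    simp only [map_pow, FreeGroup.lift_apply_of, genImage]
    rw [← map_pow, pow_two, Equiv.swap_mul_self, map_one]
  | r_braid i =>
    simp only [map_pow, map_mul, FreeGroup.lift_apply_of, genImage]
    rw [← map_mul, ← map_pow]
    have h : (Equiv.swap i (i + 1) * Equiv.swap (i + 1) (i + 1 + 1)) ^ 3
        = (1 : Equiv.Perm ℕ) := by
      obtain ⟨hab, hbc, hac⟩ : i ≠ i + 1 ∧ i + 1 ≠ i + 1 + 1 ∧ i ≠ i + 1 + 1 := by omega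
      generalize i + 1 + 1 = c at *
      generalize i + 1 = b at *
      ext x
      simp only [pow_succ, pow_zero, one_mul, Equiv.Perm.mul_apply, Equiv.Perm.one_apply]
      by_cases h0 : x = i
      · subst h0
        simp [Equiv.swap_apply_of_ne_of_ne hab hac,
          Equiv.swap_apply_of_ne_of_ne hac.symm hbc.symm]
      by_cases h1 : x = b
      · subst h1
        simp [Equiv.swap_apply_of_ne_of_ne hab hac,
          Equiv.swap_apply_of_ne_of_ne hac.symm hbc.symm]
      by_cases h2 : x = c
      · subst h2
        simp [Equiv.swap_apply_of_ne_of_ne hab hac,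
          Equiv.swap_apply_of_ne_of_ne hac.symm hbc.symm]
      simp [Equiv.swap_apply_of_ne_of_ne h0 h1, Equiv.swap_apply_of_ne_of_ne h1 h2]
    rw [h, map_one]
  | r_comm i j h =>
    simp only [map_mul, map_inv, FreeGroup.lift_apply_of, genImage, one_mul]
    rw [mul_inv_eq_one, ← map_mul, ← map_mul]
    congr 1
    ext x
    simp only [Equiv.Perm.mul_apply, Equiv.swap_apply_def]
    split_ifs <;> omega
  | eta_pow j =>
    simp only [map_pow, FreeGroup.lift_apply_of, genImage]
    rw [← map_pow, ← Pi.mulSingle_pow, ← ofAdd_nsmul]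
    simp
  | eta_comm j k h =>
    simp only [map_mul, map_inv, FreeGroup.lift_apply_of, genImage, one_mul]
    rw [mul_inv_eq_one, ← map_mul, ← map_mul, mul_comm]
  | r_eta i j =>
    simp only [map_mul, map_inv, FreeGroup.lift_apply_of, genImage, one_mul]
    rw [mul_inv_eq_one, ← map_inv, ← SemidirectProduct.inl_aut]
    congr 1
    funext x
    have h : (Equiv.swap i (i + 1))⁻¹ x = j ↔ x = Equiv.swap i (i + 1) j :=
      Equiv.Perm.inv_eq_iff_eq
    change (Pi.mulSingle j (Multiplicative.ofAdd 1) : ℕ → Multiplicative (ZMod m))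
      ((Equiv.swap i (i + 1))⁻¹ x) = _
    simp only [Pi.mulSingle_apply, h]

/-- The canonical homomorphism `Φ : G'_∞ → G_∞ ⊆ (ℤ/m)^ℕ ⋊ Sym(ℕ)`. -/
def Phi (m : ℕ) : GInf' m →* Mono m :=
  PresentedGroup.toGroup (genImage_relator m)

/-- `supp(g') = supp(d) ∪ supp(σ)` for `Φ(g') = (d, σ)`. -/
def supp {m : ℕ} (g : GInf' m) : Set ℕ :=
  {j | (Phi m g).left j ≠ 1 ∨ (Phi m g).right j ≠ j}

/-! ### Characters -/

open scoped ComplexOrder in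
/-- Positive-definite functions on a group: all matrices `(f (g_i⁻¹ g_j))_{i,j}` are positive
semidefinite. -/
def IsPosDef {G : Type*} [Group G] (f : G → ℂ) : Prop :=
  ∀ (n : ℕ) (g : Fin n → G), (Matrix.of fun i j => f ((g i)⁻¹ * g j)).PosSemidef

/-- `K₁(G)` for a discrete group `G`: central positive-definite functions `f` with `f(e) = 1`. -/
def K1 (G : Type*) [Group G] : Set (G → ℂ) :=
  {f | IsPosDef f ∧ (∀ g h : G, f (h * g * h⁻¹) = f g) ∧ f 1 = 1}

/-- `E(G)`: the (normalized) characters of `G`, that is, the extremal elements of the convex set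
`K₁(G)`. -/
def E (G : Type*) [Group G] : Set (G → ℂ) := (K1 G).extremePoints ℝ

/-- `f(h'k') = f(h') f(k')` whenever `h'`, `k'` have disjoint supports. -/
def Factorisable {m : ℕ} (f : GInf' m → ℂ) : Prop :=
  ∀ h k : GInf' m, Disjoint (supp h) (supp k) → f (h * k) = f h * f k

/-- `F(G'_∞)`: the factorisable elements of `K₁(G'_∞)`. -/
def F (m : ℕ) : Set (GInf' m → ℂ) := {f | f ∈ K1 (GInf' m) ∧ Factorisable f}

/-! ### Spin types -/

/-- The labels of the eight characters of `Z = ⟨z₁⟩ × ⟨z₂⟩ × ⟨z₃⟩`. -/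
inductive SpinType : Type
  | I | II | III | IV | V | VI | VII | VIII

/-- `χ^Y = (β₁, β₂, β₃)`, where `β_k = χ^Y(z_k)`. The triples of signs are the elements of the dual
group of `Z`, and their product is the pointwise one. -/
def SpinType.chi : SpinType → (Fin 3 → ℤˣ)
  | .I => ![-1, -1, -1]
  | .II => ![-1, -1, 1]
  | .III => ![-1, 1, -1]
  | .IV => ![-1, 1, 1]
  | .V => ![1, -1, -1]
  | .VI => ![1, -1, 1]
  | .VII => ![1, 1, -1]
  | .VIII => ![1, 1, 1]

/-- Spin types of the first kind: I, IV, V, VI, VIII. -/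
def SpinType.FirstKind : SpinType → Prop
  | .I | .IV | .V | .VI | .VIII => True
  | .II | .III | .VII => False

/-- `f` has spin type `χ = (β₁, β₂, β₃)`: `f(z g') = χ(z) f(g')` for all
`z = z₁^a z₂^b z₃^c ∈ Z` and all `g'`. -/
def HasSpinType {m : ℕ} (f : GInf' m → ℂ) (β : Fin 3 → ℤˣ) : Prop :=
  ∀ (a b c : ℕ) (g : GInf' m),
    f (zc m 0 ^ a * zc m 1 ^ b * zc m 2 ^ c * g) =
      (((β 0 ^ a * β 1 ^ b * β 2 ^ c : ℤˣ) : ℤ) : ℂ) * f g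

/-- `E(G'_∞; χ^Y)`: the characters of spin type `χ^Y`. -/
def ESpin (m : ℕ) (Y : SpinType) : Set (GInf' m → ℂ) :=
  {f | f ∈ E (GInf' m) ∧ HasSpinType f Y.chi}

/-- `F(G'_∞; χ^Y)`: the factorisable elements of `K₁(G'_∞)` of spin type `χ^Y`. -/
def FSpin (m : ℕ) (Y : SpinType) : Set (GInf' m → ℂ) :=
  {f | f ∈ F m ∧ HasSpinType f Y.chi}

end SpinChar

/-! The proof compares factorisability with extremality. Products stay in `K1` by Schur's theorem on
Hadamard products, and products of factorisable functions are visibly factorisable. So it suffices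
that factorisable functions are extremal (`mem_E_of_mem_F`) and that the products in question are
factorisable. Two facts about the group are needed. Elements with disjoint supports commute up to a
central element depending only on their parities `(sgn σ, (-1)^{ord d})`
(`parityCommute_of_disjoint`). If `h`, `k` have disjoint supports, `h` has infinitely many
conjugates `x i`, with pairwise disjoint supports escaping to infinity, by elements commuting with
`k` (`exists_disjoint_conjugates`). For factorisable `f` this gives `f ((x i)⁻¹ * x j) = |f h|²`;
averaging over `i` and Cauchy–Schwarz in each term of a convex decomposition of `f` force the terms
to agree at `h` (`mem_E_of_conjugates`). Conversely, `f (h * k) = f h * f k` is obtained from the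
parity `p` of `h` in three ways. If `χ` gives `p` the sign `1` against every parity, distant
conjugates of `h` are asymptotically central and an extremal `f` sees them as scalars. If `h`
anticommutes with its disjoint conjugates, these are orthogonal and `f (h * k) = 0`. If `χ(z₂) = -1`
and the components of `p` have product `-1`, a product of evenly many `η̂_j` anticommutes with `h`
and commutes with a distant conjugate of `k`, so again `f (h * k) = 0`. For types of the first kind
these cases exhaust all parities. For V and VI every nontrivial parity leads to vanishing, even
without extremality. Hence in (ii) a factor or the product itself kills nontrivial parities, while
at trivial parity the first case applies to both factors, whatever their types. -/

namespace SpinChar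

/-! ### A coset normal form for monomial groups -/

section NormalForm

variable {Q : Type*} [Group Q]

/-- The subgroup generated by the `R i` and `H j` that only involve the points below `n`. -/
def belowSubgroup (R H : ℕ → Q) (n : ℕ) : Subgroup Q :=
  Subgroup.closure ({x | ∃ i, i + 1 < n ∧ x = R i} ∪ {x | ∃ j, j < n ∧ x = H j})

theorem belowSubgroup_mono (R H : ℕ → Q) {n k : ℕ} (h : n ≤ k) :
    belowSubgroup R H n ≤ belowSubgroup R H k := by
  apply Subgroup.closure_mono
  rintro x (⟨i, hi, rfl⟩ | ⟨i, hi, rfl⟩)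
  · exact Or.inl ⟨i, by omega, rfl⟩
  · exact Or.inr ⟨i, by omega, rfl⟩

theorem R_mem_belowSubgroup (R H : ℕ → Q) {n i : ℕ} (h : i + 1 < n) :
    R i ∈ belowSubgroup R H n :=
  Subgroup.subset_closure (Or.inl ⟨i, h, rfl⟩)

theorem H_mem_belowSubgroup (R H : ℕ → Q) {n j : ℕ} (h : j < n) :
    H j ∈ belowSubgroup R H n :=
  Subgroup.subset_closure (Or.inr ⟨j, h, rfl⟩)

/-- `descent R j l = R (j + l - 1) * ⋯ * R (j + 1) * R j`. -/
def descent (R : ℕ → Q) : ℕ → ℕ → Q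
  | _, 0 => 1
  | j, l + 1 => descent R (j + 1) l * R j

/-- The relations of the infinite monomial group, without the power relations of the `H j`. -/
structure MonomialRelations (R H : ℕ → Q) : Prop where
  sq : ∀ i, R i * R i = 1
  braid : ∀ i, R i * R (i + 1) * R i = R (i + 1) * R i * R (i + 1)
  comm : ∀ i j, i + 2 ≤ j → Commute (R i) (R j)
  H_comm : ∀ i j, Commute (H i) (H j)
  R_H : ∀ i j, SemiconjBy (R i) (H j) (H (Equiv.swap i (i + 1) j))

variable {R H : ℕ → Q}

theorem MonomialRelations.descent_comm (rel : MonomialRelations R H) (l : ℕ) :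
    ∀ i j, i + 2 ≤ j → Commute (descent R j l) (R i) := by
  induction l with
  | zero => intro i j _; exact Commute.one_left _
  | succ l ih =>
    intro i j h
    exact (ih i (j + 1) (by omega)).mul_left (rel.comm i j h).symm

/-- The braid relation is needed only when `i` is the lowest index `j` of the descent; for larger
`i` the factor `R j` commutes past and the induction applies. -/
theorem MonomialRelations.descent_shift (rel : MonomialRelations R H) (l : ℕ) :
    ∀ i j, j ≤ i → i + 1 < j + l → SemiconjBy (descent R j l) (R (i + 1)) (R i) := by
  induction l with
  | zero => intro i j _ _; omega
  | succ l ih =>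
    intro i j h h'
    rcases h.eq_or_lt with rfl | h
    · obtain ⟨l, rfl⟩ : ∃ k, l = k + 1 := ⟨l - 1, by omega⟩
      have hc := rel.descent_comm l j (j + 1 + 1) (by omega)
      have hb := rel.braid j
      simp only [SemiconjBy, descent, Commute] at *
      calc _ = descent R (j + 1 + 1) l * (R (j + 1) * R j * R (j + 1)) := by group
        _ = (descent R (j + 1 + 1) l * R j) * R (j + 1) * R j := by rw [← hb]; group
        _ = _ := by rw [hc]; group
    · exact (ih i (j + 1) h (by omega)).mul_left (rel.comm j (i + 1) (by omega))

theorem MonomialRelations.descent_H (rel : MonomialRelations R H) (l : ℕ) :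
    ∀ i j, i ≤ j + l → ∃ p ≤ j + l, SemiconjBy (descent R j l) (H i) (H p) := by
  induction l with
  | zero => intro i j h; exact ⟨i, h, SemiconjBy.one_left _⟩
  | succ l ih =>
    intro i j h
    obtain ⟨p, hp, hs⟩ := ih (Equiv.swap j (j + 1) i) (j + 1) (by
      rw [Equiv.swap_apply_def]; split_ifs <;> omega)
    exact ⟨p, by omega, hs.mul_left (rel.R_H j i)⟩

/-- The descents ending at level `n` are the usual representatives of the right cosets of one
symmetric group in the next. The set of normal forms contains `1` and is stable under right
multiplication by the generators and their inverses. -/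
theorem MonomialRelations.exists_normalForm (rel : MonomialRelations R H) {n : ℕ} {g : Q}
    (hg : g ∈ belowSubgroup R H (n + 1)) :
    ∃ h ∈ belowSubgroup R H n, ∃ k : ℤ, ∃ j l, j + l = n ∧ g = h * H n ^ k * descent R j l := by
  have stepR : ∀ i, i < n → ∀ g : Q,
      (∃ h ∈ belowSubgroup R H n, ∃ k : ℤ, ∃ j l, j + l = n ∧ g = h * H n ^ k * descent R j l) →
      (∃ h ∈ belowSubgroup R H n, ∃ k : ℤ, ∃ j l, j + l = n ∧
        g * R i = h * H n ^ k * descent R j l) := by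
    rintro i hi _ ⟨h, hh, k, j, l, hjl, rfl⟩
    have comm : ∀ i, i + 1 < n → Commute (H n ^ k) (R i) := by
      intro i hi
      have := rel.R_H i n
      rw [Equiv.swap_apply_of_ne_of_ne (by omega) (by omega)] at this
      exact (this.zpow_right k).symm
    -- `R i` passes through the descent unchanged if `i + 1 < j`, lengthens it if `i + 1 = j`,
    -- shortens it if `i = j`, and passes through as `R (i - 1)` if `i > j`.
    rcases lt_trichotomy (i + 1) j with hij | rfl | hij
    · refine ⟨h * R i, mul_mem hh (R_mem_belowSubgroup R H (by omega)), k, j, l, hjl, ?_⟩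
      have h1 := (rel.descent_comm l i j hij).eq
      have h2 := (comm i (by omega)).eq
      rw [mul_assoc, h1, ← mul_assoc, mul_assoc h, h2]; group
    · exact ⟨h, hh, k, i, l + 1, by omega, by rw [descent]; group⟩
    · rcases (Nat.lt_succ_iff.mp hij).eq_or_lt with rfl | hij
      · obtain ⟨l, rfl⟩ : ∃ q, l = q + 1 := ⟨l - 1, by omega⟩
        refine ⟨h, hh, k, j + 1, l, by omega, ?_⟩
        simp only [descent, mul_assoc, rel.sq, mul_one]
      · obtain ⟨i, rfl⟩ : ∃ q, i = q + 1 := ⟨i - 1, by omega⟩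
        refine ⟨h * R i, mul_mem hh (R_mem_belowSubgroup R H (by omega)), k, j, l, hjl, ?_⟩
        have h1 := (rel.descent_shift l i j (by omega) (by omega)).eq
        have h2 := (comm i (by omega)).eq
        rw [mul_assoc, h1, ← mul_assoc, mul_assoc h, h2]; group
  have stepH : ∀ i, i < n + 1 → ∀ ε : ℤ, ∀ g : Q,
      (∃ h ∈ belowSubgroup R H n, ∃ k : ℤ, ∃ j l, j + l = n ∧ g = h * H n ^ k * descent R j l) →
      (∃ h ∈ belowSubgroup R H n, ∃ k : ℤ, ∃ j l, j + l = n ∧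
        g * H i ^ ε = h * H n ^ k * descent R j l) := by
    rintro i hi ε _ ⟨h, hh, k, j, l, hjl, rfl⟩
    obtain ⟨p, hp, hs⟩ := rel.descent_H l i j (by omega)
    have h1 := (hs.zpow_right ε).eq
    rcases (hjl ▸ hp : p ≤ n).eq_or_lt with rfl | hp
    · refine ⟨h, hh, k + ε, j, l, hjl, ?_⟩
      rw [mul_assoc, h1, zpow_add]; group
    · refine ⟨h * H p ^ ε, mul_mem hh (zpow_mem (H_mem_belowSubgroup R H hp) _), k, j, l, hjl, ?_⟩
      have h2 := ((rel.H_comm n p).zpow_zpow k ε).eq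
      rw [mul_assoc, h1, ← mul_assoc, mul_assoc h, h2]; group
  induction hg using Subgroup.closure_induction_right with
  | one => exact ⟨1, one_mem _, 0, n, 0, by simp, by simp [descent]⟩
  | mul_right x _ y hy ih =>
    rcases hy with ⟨i, hi, rfl⟩ | ⟨i, hi, rfl⟩
    · exact stepR i (by omega) _ ih
    · simpa using stepH i hi 1 _ ih
  | mul_inv_cancel x _ y hy ih =>
    rcases hy with ⟨i, hi, rfl⟩ | ⟨i, hi, rfl⟩
    · rw [inv_eq_of_mul_eq_one_left (rel.sq i)]
      exact stepR i (by omega) _ ih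
    · simpa using stepH i hi (-1) _ ih

end NormalForm

/-! ### Generators and relations of `G'_∞` -/

section Relations

variable (m : ℕ)

/-- The generator `r_i` of `G'_∞`. -/
def rg (i : ℕ) : GInf' m := PresentedGroup.of (Gen.r i)

/-- The generator `η̂_j` of `G'_∞`. -/
def eg (j : ℕ) : GInf' m := PresentedGroup.of (Gen.eta j)

theorem zc_comm (k : Fin 3) (g : GInf' m) : Commute (zc m k) g := by
  have h : g ∈ Subgroup.centralizer {zc m k} := by
    refine PresentedGroup.generated_by _ (Subgroup.centralizer {zc m k}) ?_ g
    intro x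
    rw [Subgroup.mem_centralizer_singleton_iff]
    have h : PresentedGroup.mk {w | Relator m w} _ = 1 :=
      PresentedGroup.one_of_mem (Relator.z_central (m := m) k x)
    rw [map_mul, map_inv, mul_inv_eq_one, map_mul, map_mul] at h
    exact h.symm
  exact (Subgroup.mem_centralizer_singleton_iff.mp h).symm

theorem zc_sq (k : Fin 3) : zc m k * zc m k = 1 := by
  have h : PresentedGroup.mk {w | Relator m w} _ = 1 :=
    PresentedGroup.one_of_mem (Relator.z_sq (m := m) k)
  rw [map_pow, pow_two] at h
  exact h

theorem rg_sq (i : ℕ) : rg m i * rg m i = 1 := by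
  have h : PresentedGroup.mk {w | Relator m w} _ = 1 :=
    PresentedGroup.one_of_mem (Relator.r_sq (m := m) i)
  rw [map_pow, pow_two] at h
  exact h

theorem rg_braid (i : ℕ) :
    rg m i * rg m (i + 1) * rg m i = rg m (i + 1) * rg m i * rg m (i + 1) := by
  have h : PresentedGroup.mk {w | Relator m w} _ = 1 :=
    PresentedGroup.one_of_mem (Relator.r_braid (m := m) i)
  rw [map_pow, map_mul] at h
  have h' : (rg m i * rg m (i + 1) * rg m i) * (rg m (i + 1) * rg m i * rg m (i + 1)) = 1 := by
    rw [← h]; simp only [pow_succ, pow_zero, one_mul, mul_assoc]; rfl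
  rw [← inv_eq_of_mul_eq_one_left h']
  simp [mul_assoc, inv_eq_of_mul_eq_one_left (rg_sq m _)]

theorem rg_comm {i j : ℕ} (hij : i + 2 ≤ j) :
    rg m i * rg m j = zc m 0 * (rg m j * rg m i) := by
  have h : PresentedGroup.mk {w | Relator m w} _ = 1 :=
    PresentedGroup.one_of_mem (Relator.r_comm (m := m) i j hij)
  rw [map_mul, map_inv, mul_inv_eq_one, map_mul, map_mul, map_mul, mul_assoc] at h
  exact h

theorem eg_pow (j : ℕ) : eg m j ^ m = 1 := by
  have h : PresentedGroup.mk {w | Relator m w} _ = 1 :=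
    PresentedGroup.one_of_mem (Relator.eta_pow (m := m) j)
  rw [map_pow] at h
  exact h

theorem eg_comm {i j : ℕ} (hij : i ≠ j) :
    eg m i * eg m j = zc m 1 * (eg m j * eg m i) := by
  have h : PresentedGroup.mk {w | Relator m w} _ = 1 :=
    PresentedGroup.one_of_mem (Relator.eta_comm (m := m) i j hij)
  rw [map_mul, map_inv, mul_inv_eq_one, map_mul, map_mul, map_mul, mul_assoc] at h
  exact h

theorem rg_eg (i j : ℕ) :
    rg m i * eg m j = zc m 2 * (eg m (Equiv.swap i (i + 1) j) * rg m i) := by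
  have h : PresentedGroup.mk {w | Relator m w} _ = 1 :=
    PresentedGroup.one_of_mem (Relator.r_eta (m := m) i j)
  rw [map_mul, map_inv, mul_inv_eq_one, map_mul, map_mul, map_inv, map_mul,
    mul_inv_eq_iff_eq_mul, mul_assoc] at h
  exact h

theorem Phi_zc (k : Fin 3) : Phi m (zc m k) = 1 := PresentedGroup.toGroup.of _

theorem Phi_rg (i : ℕ) : Phi m (rg m i) = SemidirectProduct.inr (Equiv.swap i (i + 1)) :=
  PresentedGroup.toGroup.of _

theorem Phi_eg (j : ℕ) : Phi m (eg m j) =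
    SemidirectProduct.inl (Pi.mulSingle j (Multiplicative.ofAdd 1)) :=
  PresentedGroup.toGroup.of _

/-- The central subgroup `Z`. -/
def zSubgroup : Subgroup (GInf' m) := Subgroup.closure (Set.range (zc m))

theorem zc_mem_zSubgroup (k : Fin 3) : zc m k ∈ zSubgroup m :=
  Subgroup.subset_closure ⟨k, rfl⟩

theorem zSubgroup_le_center : zSubgroup m ≤ Subgroup.center (GInf' m) := by
  rw [zSubgroup, Subgroup.closure_le]
  rintro _ ⟨k, rfl⟩
  exact Subgroup.mem_center_iff.mpr fun g => (zc_comm m k g).eq.symm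

instance : (zSubgroup m).Normal :=
  ⟨fun z hz g => by
    rw [Subgroup.mem_center_iff.mp (zSubgroup_le_center m hz) g, mul_inv_cancel_right]; exact hz⟩

theorem Phi_of_mem_zSubgroup {z : GInf' m} (hz : z ∈ zSubgroup m) : Phi m z = 1 := by
  have h : zSubgroup m ≤ (Phi m).ker := by
    rw [zSubgroup, Subgroup.closure_le]
    rintro _ ⟨k, rfl⟩
    exact Phi_zc m k
  exact h hz

theorem mk'_zc (k : Fin 3) : QuotientGroup.mk' (zSubgroup m) (zc m k) = 1 :=
  (QuotientGroup.eq_one_iff _).mpr (zc_mem_zSubgroup m k)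

/-- Modulo `Z` all signs disappear, so the normal form is available in the quotient and is lifted
back up to an element of `Z`. -/
theorem monomialRelations_mk' : MonomialRelations
    (fun i => QuotientGroup.mk' (zSubgroup m) (rg m i))
    (fun j => QuotientGroup.mk' (zSubgroup m) (eg m j)) where
  sq i := by rw [← map_mul, rg_sq, map_one]
  braid i := by simp only [← map_mul, rg_braid]
  comm i j h := by
    rw [commute_iff_eq, ← map_mul, rg_comm m h, map_mul, mk'_zc, one_mul, map_mul]
  H_comm i j := by
    rcases eq_or_ne i j with rfl | h
    · exact Commute.refl _
    · rw [commute_iff_eq, ← map_mul, eg_comm m h, map_mul, mk'_zc, one_mul, map_mul]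
  R_H i j := by
    rw [SemiconjBy, ← map_mul, rg_eg m, map_mul, mk'_zc, one_mul, map_mul]

/-- The subgroup of `G'_∞` generated by `r_i`, `i + 1 < n`, and `η̂_j`, `j < n`. -/
abbrev below (n : ℕ) : Subgroup (GInf' m) := belowSubgroup (rg m) (eg m) n

theorem map_below (n : ℕ) : (below m n).map (QuotientGroup.mk' (zSubgroup m)) =
    belowSubgroup (fun i => QuotientGroup.mk' (zSubgroup m) (rg m i))
      (fun j => QuotientGroup.mk' (zSubgroup m) (eg m j)) n := by
  rw [below, belowSubgroup, MonoidHom.map_closure, belowSubgroup]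
  congr 1
  ext x
  constructor
  · rintro ⟨_, ⟨i, hi, rfl⟩ | ⟨i, hi, rfl⟩, rfl⟩
    · exact Or.inl ⟨i, hi, rfl⟩
    · exact Or.inr ⟨i, hi, rfl⟩
  · rintro (⟨i, hi, rfl⟩ | ⟨i, hi, rfl⟩)
    · exact ⟨_, Or.inl ⟨i, hi, rfl⟩, rfl⟩
    · exact ⟨_, Or.inr ⟨i, hi, rfl⟩, rfl⟩

theorem mem_sup_below_iff {n : ℕ} {g : GInf' m} : g ∈ zSubgroup m ⊔ below m n ↔
    QuotientGroup.mk' (zSubgroup m) g ∈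
      belowSubgroup (fun i => QuotientGroup.mk' (zSubgroup m) (rg m i))
        (fun j => QuotientGroup.mk' (zSubgroup m) (eg m j)) n := by
  rw [← map_below, ← Subgroup.mem_comap, Subgroup.comap_map_eq, QuotientGroup.ker_mk', sup_comm]

theorem exists_mem_sup_below (g : GInf' m) : ∃ n, g ∈ zSubgroup m ⊔ below m n := by
  have hmono : Monotone fun n => zSubgroup m ⊔ below m n :=
    fun a b h => sup_le_sup le_rfl (belowSubgroup_mono _ _ h)
  have h : g ∈ ⨆ n, zSubgroup m ⊔ below m n := by
    refine PresentedGroup.generated_by _ (⨆ n, zSubgroup m ⊔ below m n) ?_ g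
    rintro (k | i | j)
    · exact Subgroup.mem_iSup_of_mem 0 (Subgroup.mem_sup_left (zc_mem_zSubgroup m k))
    · exact Subgroup.mem_iSup_of_mem (i + 2)
        (Subgroup.mem_sup_right (R_mem_belowSubgroup _ _ (by omega)))
    · exact Subgroup.mem_iSup_of_mem (j + 1)
        (Subgroup.mem_sup_right (H_mem_belowSubgroup _ _ (by omega)))
  exact (Subgroup.mem_iSup_of_directed hmono.directed_le).mp h

end Relations

/-! ### Supports -/

section Supp

variable {m : ℕ}

theorem notMem_supp {g : GInf' m} {j : ℕ} :
    j ∉ supp g ↔ (Phi m g).left j = 1 ∧ (Phi m g).right j = j := by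
  simp [supp]

theorem notMem_supp_mul {g h : GInf' m} {j : ℕ} (hg : j ∉ supp g) (hh : j ∉ supp h) :
    j ∉ supp (g * h) := by
  rw [notMem_supp] at *
  have e : (Phi m g).right⁻¹ j = j := by rw [Equiv.Perm.inv_eq_iff_eq, hg.2]
  simp only [map_mul, SemidirectProduct.mul_left, SemidirectProduct.mul_right]
  refine ⟨?_, by rw [Equiv.Perm.mul_apply, hh.2, hg.2]⟩
  change (Phi m g).left j * (Phi m h).left ((Phi m g).right⁻¹ j) = 1
  rw [e, hg.1, hh.1, one_mul]

theorem notMem_supp_inv {g : GInf' m} {j : ℕ} (hg : j ∉ supp g) : j ∉ supp g⁻¹ := by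
  rw [notMem_supp] at *
  simp only [map_inv, SemidirectProduct.inv_left, SemidirectProduct.inv_right]
  refine ⟨?_, by rw [Equiv.Perm.inv_eq_iff_eq, hg.2]⟩
  change ((Phi m g).left⁻¹) ((Phi m g).right⁻¹⁻¹ j) = 1
  rw [inv_inv, hg.2, Pi.inv_apply, hg.1, inv_one]

theorem supp_one : supp (1 : GInf' m) = ∅ := by
  ext j; simp [supp]

theorem supp_inv (g : GInf' m) : supp g⁻¹ = supp g := by
  ext j
  refine not_iff_not.mp ⟨fun h => ?_, notMem_supp_inv⟩
  simpa using notMem_supp_inv h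

theorem exists_of_mem_supp_conj {c g : GInf' m} {j : ℕ} (h : j ∈ supp (c * g * c⁻¹)) :
    ∃ i ∈ supp g, j = (Phi m c).right i := by
  refine ⟨(Phi m c).right⁻¹ j, ?_, by simp⟩
  by_contra hi
  refine absurd h ?_
  obtain ⟨i, rfl⟩ := (Phi m c).right.surjective j
  have hπ : (Phi m c).right⁻¹ ((Phi m c).right i) = i := by simp
  rw [hπ, notMem_supp] at hi
  rw [notMem_supp]
  have e : (Phi m g).right⁻¹ i = i := by rw [Equiv.Perm.inv_eq_iff_eq, hi.2]
  simp only [map_mul, map_inv, SemidirectProduct.mul_left, SemidirectProduct.mul_right,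
    SemidirectProduct.inv_left, SemidirectProduct.inv_right]
  refine ⟨?_, by simp [hi.2]⟩
  change (Phi m c).left ((Phi m c).right i) *
    (Phi m g).left ((Phi m c).right⁻¹ ((Phi m c).right i)) *
    ((Phi m c).left⁻¹) ((Phi m c).right⁻¹⁻¹ (((Phi m c).right * (Phi m g).right)⁻¹
      ((Phi m c).right i))) = 1
  rw [mul_inv_rev, Equiv.Perm.mul_apply, hπ, e, hi.1, inv_inv,
    Pi.inv_apply, mul_one, mul_inv_cancel]

theorem supp_of_Phi_eq_one {g : GInf' m} (h : Phi m g = 1) : supp g = ∅ := by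
  ext j; simp [supp, h]

theorem supp_rg_subset (i : ℕ) : supp (rg m i) ⊆ {i, i + 1} := by
  intro j hj
  by_contra h
  simp only [Set.mem_insert_iff, Set.mem_singleton_iff, not_or] at h
  refine (notMem_supp.mpr ?_) hj
  rw [Phi_rg]
  exact ⟨rfl, Equiv.swap_apply_of_ne_of_ne h.1 h.2⟩

theorem supp_eg_subset (i : ℕ) : supp (eg m i) ⊆ {i} := by
  intro j hj
  by_contra h
  refine (notMem_supp.mpr ?_) hj
  rw [Phi_eg]
  exact ⟨Pi.mulSingle_eq_of_ne h _, rfl⟩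

/-- The subgroup of the elements whose support lies in `A`. -/
def supportedIn (A : Set ℕ) : Subgroup (GInf' m) where
  carrier := {g | supp g ⊆ A}
  mul_mem' {g h} hg hh := fun j hj => by
    by_contra hA
    exact notMem_supp_mul (fun h => hA (hg h)) (fun h => hA (hh h)) hj
  one_mem' := by simp [supp_one]
  inv_mem' {g} hg := by simpa [supp_inv] using hg

theorem mem_supportedIn {A : Set ℕ} {g : GInf' m} : g ∈ supportedIn A ↔ supp g ⊆ A := Iff.rfl

theorem sup_below_le_supportedIn (n : ℕ) :
    zSubgroup m ⊔ below m n ≤ supportedIn (Set.Iio n) := by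
  refine sup_le (fun z hz => ?_) ?_
  · rw [mem_supportedIn, supp_of_Phi_eq_one (Phi_of_mem_zSubgroup m hz)]
    exact Set.empty_subset _
  · rw [below, belowSubgroup, Subgroup.closure_le]
    rintro x (⟨i, hi, rfl⟩ | ⟨i, hi, rfl⟩) j hj
    · have := supp_rg_subset i hj
      simp only [Set.mem_insert_iff, Set.mem_singleton_iff] at this
      simp only [Set.mem_Iio]; omega
    · have := supp_eg_subset i hj
      simp only [Set.mem_singleton_iff] at this
      simp only [Set.mem_Iio]; omega

theorem supp_finite_bound (g : GInf' m) : ∃ n, supp g ⊆ Set.Iio n :=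
  (exists_mem_sup_below m g).imp fun n hn => sup_below_le_supportedIn n hn

theorem mk'_descent (j l : ℕ) : QuotientGroup.mk' (zSubgroup m) (descent (rg m) j l) =
    descent (fun i => QuotientGroup.mk' (zSubgroup m) (rg m i)) j l := by
  induction l generalizing j with
  | zero => simp [descent]
  | succ l ih => simp only [descent, map_mul, ih]

theorem Phi_descent (j l : ℕ) : ∃ π : Equiv.Perm ℕ,
    Phi m (descent (rg m) j l) = SemidirectProduct.inr π ∧ π j = j + l := by
  induction l generalizing j with
  | zero => exact ⟨1, by simp [descent], by simp⟩
  | succ l ih =>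
    obtain ⟨π, h1, h2⟩ := ih (j + 1)
    refine ⟨π * Equiv.swap j (j + 1), ?_, ?_⟩
    · rw [descent, map_mul, h1, Phi_rg, ← map_mul]
    · rw [Equiv.Perm.mul_apply, Equiv.swap_apply_left, h2]; omega

/-- The descent sends `j` to `n`, so fixing `n` forces `j = n` and an empty descent. The coordinate
of `d` at `n` is then `k` mod `m`, and `η̂_n ^ m = 1` removes the remaining factor. -/
theorem normalForm_trivial {n : ℕ} {h : GInf' m} (hhn : n ∉ supp h) {k : ℤ} {j l : ℕ}
    (hjl : j + l = n) (hn : n ∉ supp (h * eg m n ^ k * descent (rg m) j l)) :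
    h * eg m n ^ k * descent (rg m) j l = h := by
  obtain ⟨π, hπ, hπj⟩ := Phi_descent (m := m) j l
  rw [notMem_supp] at hn hhn
  have hek : Phi m (eg m n ^ k) = SemidirectProduct.inl
      (Pi.mulSingle n (Multiplicative.ofAdd 1) ^ k) := by rw [map_zpow, Phi_eg, ← map_zpow]
  rw [map_mul, map_mul, hπ, hek] at hn
  have hinv : (Phi m h).right⁻¹ n = n := by rw [Equiv.Perm.inv_eq_iff_eq, hhn.2]
  have hl : l = 0 := by
    have h2 := hn.2
    simp only [SemidirectProduct.mul_right, SemidirectProduct.right_inl,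
      SemidirectProduct.right_inr, mul_one, Equiv.Perm.mul_apply] at h2
    have h3 : π n = n := (Phi m h).right.injective (h2.trans hhn.2.symm)
    have : j = n := π.injective (by rw [hπj, h3, hjl])
    omega
  subst hl
  have hk : eg m n ^ k = 1 := by
    have h1 := hn.1
    simp only [SemidirectProduct.mul_left, SemidirectProduct.left_inl,
      SemidirectProduct.left_inr, map_one, mul_one] at h1
    change (Phi m h).left n * ((Pi.mulSingle n (Multiplicative.ofAdd 1) ^ k :
      ℕ → Multiplicative (ZMod m))) ((Phi m h).right⁻¹ n) = 1 at h1
    rw [hinv, hhn.1, one_mul, Pi.pow_apply, Pi.mulSingle_eq_same, ← ofAdd_zsmul,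
      ofAdd_eq_one, zsmul_one, CharP.intCast_eq_zero_iff (ZMod m) m] at h1
    obtain ⟨q, rfl⟩ := h1
    rw [zpow_mul, zpow_natCast, eg_pow, one_zpow]
  rw [hk, descent, mul_one, mul_one]

theorem exists_normalForm_below {n : ℕ} {g : GInf' m} (h : g ∈ zSubgroup m ⊔ below m (n + 1)) :
    ∃ z ∈ zSubgroup m, ∃ h ∈ below m n, ∃ k : ℤ, ∃ j l, j + l = n ∧
      g = z * (h * eg m n ^ k * descent (rg m) j l) := by
  obtain ⟨h', hh', k, j, l, hjl, e⟩ :=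
    (monomialRelations_mk' m).exists_normalForm ((mem_sup_below_iff m).mp h)
  rw [← map_below] at hh'
  obtain ⟨h, hh, rfl⟩ := hh'
  rw [← mk'_descent, ← map_zpow, ← map_mul, ← map_mul] at e
  refine ⟨g * (h * eg m n ^ k * descent (rg m) j l)⁻¹, ?_, h, hh, k, j, l, hjl, by group⟩
  rw [← QuotientGroup.eq_one_iff]
  change QuotientGroup.mk' _ _ = 1
  rw [map_mul, map_inv, e, mul_inv_cancel]

theorem mem_sup_below_of_succ {n : ℕ} {g : GInf' m} (hg : n ∉ supp g)
    (hg' : g ∈ zSubgroup m ⊔ below m (n + 1)) : g ∈ zSubgroup m ⊔ below m n := by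
  obtain ⟨z, hz, h, hh, k, j, l, hjl, rfl⟩ := exists_normalForm_below hg'
  have hzs : n ∉ supp z⁻¹ := by
    rw [supp_inv, supp_of_Phi_eq_one (Phi_of_mem_zSubgroup m hz)]; simp
  have hhn : n ∉ supp h := fun h' => by
    simpa using sup_below_le_supportedIn n (Subgroup.mem_sup_right hh) h'
  have hn := notMem_supp_mul hzs hg
  rw [inv_mul_cancel_left] at hn
  rw [normalForm_trivial hhn hjl hn]
  exact mul_mem (Subgroup.mem_sup_left hz) (Subgroup.mem_sup_right hh)

/-- Turns a condition on the support into a word in the generators, lowering the bound one point at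
a time. The case `n = 0` identifies the kernel of `Φ`. -/
theorem mem_sup_below_of_supp {n : ℕ} {g : GInf' m} (hg : supp g ⊆ Set.Iio n) :
    g ∈ zSubgroup m ⊔ below m n := by
  have key : ∀ d, g ∈ zSubgroup m ⊔ below m (n + d) → g ∈ zSubgroup m ⊔ below m n := by
    intro d
    induction d with
    | zero => exact id
    | succ d ih =>
      intro h
      refine ih (mem_sup_below_of_succ (fun h' => ?_) h)
      have := hg h'
      simp at this
  obtain ⟨n', hn'⟩ := exists_mem_sup_below m g
  refine key n' ?_
  exact sup_le_sup le_rfl (belowSubgroup_mono _ _ (by omega)) hn'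

/-- The kernel of `Φ` is `Z`. -/
theorem mem_zSubgroup_of_Phi_eq_one {g : GInf' m} (h : Phi m g = 1) : g ∈ zSubgroup m := by
  have h0 : g ∈ zSubgroup m ⊔ below m 0 :=
    mem_sup_below_of_supp (by simp [supp_of_Phi_eq_one h])
  have : below m 0 = ⊥ := by simp [below, belowSubgroup]
  simpa [this] using h0

theorem exists_zSubgroup_mul_of_Phi_eq {g h : GInf' m} (e : Phi m g = Phi m h) :
    ∃ z ∈ zSubgroup m, g = z * h :=
  ⟨g * h⁻¹, mem_zSubgroup_of_Phi_eq_one (by rw [map_mul, map_inv, e, mul_inv_cancel]), by simp⟩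

theorem exists_mul_below_of_supp {n : ℕ} {g : GInf' m} (hg : supp g ⊆ Set.Iio n) :
    ∃ z ∈ zSubgroup m, ∃ h ∈ below m n, g = z * h := by
  obtain ⟨z, hz, h, hh, e⟩ := Subgroup.mem_sup_of_normal_left.mp (mem_sup_below_of_supp hg)
  exact ⟨z, hz, h, hh, e.symm⟩

end Supp

open scoped IsMulCommutative

/-! ### Parities and commutation of elements with disjoint supports -/

section Sign

/-- The exponent of the bicharacter of `{±1}`. -/
def signExp (u v : ℤˣ) : ℕ := if u = -1 ∧ v = -1 then 1 else 0

theorem signExp_comm (u v : ℤˣ) : signExp u v = signExp v u := by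
  simp only [signExp, and_comm]

theorem pow_signExp_mul {A : Type*} [Monoid A] {x : A} (hx : x * x = 1) (u u' v : ℤˣ) :
    x ^ signExp (u * u') v = x ^ signExp u v * x ^ signExp u' v := by
  have h : (1 : ℤˣ) ≠ -1 := by decide
  rcases Int.units_eq_one_or u with rfl | rfl <;> rcases Int.units_eq_one_or u' with rfl | rfl <;>
    rcases Int.units_eq_one_or v with rfl | rfl <;> simp [signExp, h, hx]

variable (m : ℕ)

/-- The central element `z_k`, as an element of the centre. -/
def zcCenter (k : Fin 3) : Subgroup.center (GInf' m) :=
  ⟨zc m k, Subgroup.mem_center_iff.mpr fun g => (zc_comm m k g).eq.symm⟩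

theorem zcCenter_sq (k : Fin 3) : zcCenter m k * zcCenter m k = 1 :=
  Subtype.ext (zc_sq m k)

/-- The commutator of two elements with disjoint supports and parities `p`, `q`. -/
def eps (p q : ℤˣ × ℤˣ) : Subgroup.center (GInf' m) :=
  zcCenter m 0 ^ signExp p.1 q.1 * zcCenter m 1 ^ signExp p.2 q.2 *
    zcCenter m 2 ^ (signExp p.1 q.2 + signExp p.2 q.1)

theorem eps_mul_left (p p' q : ℤˣ × ℤˣ) : eps m (p * p') q = eps m p q * eps m p' q := by
  simp only [eps, Prod.fst_mul, Prod.snd_mul, pow_add, pow_signExp_mul (zcCenter_sq m _)]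
  simp only [mul_left_comm, mul_assoc]

theorem eps_one_left (q : ℤˣ × ℤˣ) : eps m 1 q = 1 := by
  have h : (1 : ℤˣ) ≠ -1 := by decide
  simp [eps, signExp, h]

theorem eps_comm (p q : ℤˣ × ℤˣ) : eps m p q = eps m q p := by
  simp only [eps, signExp_comm p.1, signExp_comm p.2, add_comm]

theorem parity_mul_self (p : ℤˣ × ℤˣ) : p * p = 1 :=
  Prod.ext (Int.units_mul_self _) (Int.units_mul_self _)

theorem eps_mul_self (p q : ℤˣ × ℤˣ) : eps m p q * eps m p q = 1 := by
  rw [← eps_mul_left, parity_mul_self, eps_one_left]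

end Sign

/-- The parities of the generators. -/
def genParity : Gen → ℤˣ × ℤˣ
  | Gen.z _ => 1
  | Gen.r _ => (-1, 1)
  | Gen.eta _ => (1, -1)

theorem genParity_relator {m : ℕ} (hm : Even m) (w : FreeGroup Gen)
    (hw : w ∈ {w | Relator m w}) : FreeGroup.lift genParity w = 1 := by
  have hw' : Relator m w := hw
  induction hw' with
  | z_sq k => simp [genParity]
  | z_central k x => simp [genParity]
  | r_sq i => simp [genParity]
  | r_braid i => simp [genParity]
  | r_comm i j h => simp [genParity]
  -- Evenness of `m` enters here: it makes the second sign well defined.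
  | eta_pow j => simp [genParity, hm.neg_one_pow]
  | eta_comm j k h => simp [genParity]
  | r_eta i j => simp [genParity]

/-- The pair `(sgn σ, (-1)^{ord d})` for `Φ(g') = (d, σ)`. -/
def parity {m : ℕ} (hm : Even m) : GInf' m →* ℤˣ × ℤˣ :=
  PresentedGroup.toGroup (genParity_relator hm)

section Comm

variable {m : ℕ} (hm : Even m)

theorem parity_zc (k : Fin 3) : parity hm (zc m k) = 1 := PresentedGroup.toGroup.of _

theorem parity_rg (i : ℕ) : parity hm (rg m i) = (-1, 1) := PresentedGroup.toGroup.of _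

theorem parity_eg (j : ℕ) : parity hm (eg m j) = (1, -1) := PresentedGroup.toGroup.of _

theorem parity_of_mem_zSubgroup {z : GInf' m} (hz : z ∈ zSubgroup m) : parity hm z = 1 := by
  have h : zSubgroup m ≤ (parity hm).ker := by
    rw [zSubgroup, Subgroup.closure_le]
    rintro _ ⟨k, rfl⟩
    exact parity_zc hm k
  exact h hz

theorem parity_inv (g : GInf' m) : parity hm g⁻¹ = parity hm g := by
  rw [map_inv, inv_eq_of_mul_eq_one_left (parity_mul_self _)]

theorem parity_conj (c g : GInf' m) : parity hm (c * g * c⁻¹) = parity hm g := by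
  rw [map_mul, map_mul, mul_right_comm, ← map_mul, mul_inv_cancel, map_one, one_mul]

theorem center_comm (ε : Subgroup.center (GInf' m)) (g : GInf' m) :
    g * (ε : GInf' m) = ε * g := Subgroup.mem_center_iff.mp ε.2 g

/-- `h` and `k` commute up to the central element determined by their parities. -/
def ParityCommute (h k : GInf' m) : Prop :=
  h * k = (eps m (parity hm h) (parity hm k) : GInf' m) * (k * h)

variable {hm}

theorem ParityCommute.symm {h k : GInf' m} (H : ParityCommute hm h k) :
    ParityCommute hm k h := by
  rw [ParityCommute, H, eps_comm, ← mul_assoc, ← Subgroup.coe_mul, eps_mul_self,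
    Subgroup.coe_one, one_mul]

theorem ParityCommute.mul_left {h h' k : GInf' m} (H : ParityCommute hm h k)
    (H' : ParityCommute hm h' k) : ParityCommute hm (h * h') k := by
  unfold ParityCommute at *
  rw [mul_assoc, H', ← mul_assoc, center_comm, mul_assoc, ← mul_assoc h, H, map_mul, eps_mul_left,
    mul_comm (eps m _ _), Subgroup.coe_mul]
  simp only [mul_assoc]

theorem ParityCommute.inv_left {h k : GInf' m} (H : ParityCommute hm h k) :
    ParityCommute hm h⁻¹ k := by
  have H' := H.symm
  unfold ParityCommute at *
  rw [parity_inv, eps_comm]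
  have : h⁻¹ * k = h⁻¹ * (k * h) * h⁻¹ := by group
  rw [this, H', ← mul_assoc, center_comm]
  group

variable (hm) in
/-- The subgroup of the elements that commute with `k` up to the sign given by the parities. -/
def parityCentralizer (k : GInf' m) : Subgroup (GInf' m) where
  carrier := {h | ParityCommute hm h k}
  mul_mem' := ParityCommute.mul_left
  one_mem' := by simp [ParityCommute, eps_one_left]
  inv_mem' := ParityCommute.inv_left

theorem zSubgroup_le_parityCentralizer (k : GInf' m) :
    zSubgroup m ≤ parityCentralizer hm k := by
  intro z hz
  change ParityCommute hm z k
  rw [ParityCommute, parity_of_mem_zSubgroup hm hz, eps_one_left, Subgroup.coe_one, one_mul]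
  exact (Subgroup.mem_center_iff.mp (zSubgroup_le_center m hz) k).symm

theorem ParityCommute.of_zSubgroup_mul_right {h k z : GInf' m} (hz : z ∈ zSubgroup m)
    (H : ParityCommute hm h k) : ParityCommute hm h (z * k) :=
  (ParityCommute.mul_left (zSubgroup_le_parityCentralizer h hz) H.symm).symm

theorem ParityCommute.of_conj (c : GInf' m) {h k : GInf' m}
    (H : ParityCommute hm (c * h * c⁻¹) (c * k * c⁻¹)) : ParityCommute hm h k := by
  unfold ParityCommute at *
  rw [parity_conj, parity_conj] at H
  have h1 : c * h * c⁻¹ * (c * k * c⁻¹) = c * (h * k) * c⁻¹ := by group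
  have h2 : c * k * c⁻¹ * (c * h * c⁻¹) = c * (k * h) * c⁻¹ := by group
  rw [h1, h2] at H
  refine mul_left_cancel (a := c) (mul_right_cancel (b := c⁻¹) ?_)
  rw [H, ← mul_assoc c (Subtype.val _), center_comm]
  simp only [mul_assoc]

theorem parityCommute_rg_rg {i j : ℕ} (h : i + 2 ≤ j) : ParityCommute hm (rg m i) (rg m j) := by
  have h' : (1 : ℤˣ) ≠ -1 := by decide
  rw [ParityCommute, parity_rg, parity_rg, rg_comm m h]
  simp [eps, signExp, h', zcCenter]

theorem parityCommute_rg_eg {i j : ℕ} (h : j ≠ i) (h1 : j ≠ i + 1) :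
    ParityCommute hm (rg m i) (eg m j) := by
  have h' : (1 : ℤˣ) ≠ -1 := by decide
  rw [ParityCommute, parity_rg, parity_eg, rg_eg m, Equiv.swap_apply_of_ne_of_ne h h1]
  simp [eps, signExp, h', zcCenter]

theorem parityCommute_eg_eg {i j : ℕ} (h : i ≠ j) : ParityCommute hm (eg m i) (eg m j) := by
  have h' : (1 : ℤˣ) ≠ -1 := by decide
  rw [ParityCommute, parity_eg, parity_eg, eg_comm m h]
  simp [eps, signExp, h', zcCenter]

theorem below_le_parityCentralizer_rg {i n : ℕ} (h : n ≤ i) :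
    below m n ≤ parityCentralizer hm (rg m i) := by
  rw [below, belowSubgroup, Subgroup.closure_le]
  rintro x (⟨j, hj, rfl⟩ | ⟨j, hj, rfl⟩)
  · exact parityCommute_rg_rg (by omega)
  · exact (parityCommute_rg_eg (by omega) (by omega)).symm

theorem below_le_parityCentralizer_eg {i n : ℕ} (h : n ≤ i) :
    below m n ≤ parityCentralizer hm (eg m i) := by
  rw [below, belowSubgroup, Subgroup.closure_le]
  rintro x (⟨j, hj, rfl⟩ | ⟨j, hj, rfl⟩)
  · exact parityCommute_rg_eg (by omega) (by omega)
  · exact parityCommute_eg_eg (by omega)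

/-! ### Lifts of permutations -/

/-- Adjacent transpositions act transitively on `ℕ`, hence generate all finitary permutations; lifts
that are words in the `r_i` have trivial second parity. -/
theorem exists_lift_of_finite (hm : Even m) {π : Equiv.Perm ℕ} (hπ : {j | π j ≠ j}.Finite) :
    ∃ c : GInf' m, Phi m c = SemidirectProduct.inr π ∧ (parity hm c).2 = 1 := by
  have hmem : π ∈ Subgroup.closure {σ : Equiv.Perm ℕ | ∃ i, σ = Equiv.swap i (i + 1)} := by
    have hS : ∀ f ∈ {σ : Equiv.Perm ℕ | ∃ i, σ = Equiv.swap i (i + 1)}, f.IsSwap := by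
      rintro _ ⟨i, rfl⟩
      exact ⟨i, i + 1, by omega, rfl⟩
    rw [mem_closure_isSwap hS]
    refine ⟨hπ.subset fun j hj => hj, fun x => ?_⟩
    have horb : ∀ x : ℕ, x ∈ MulAction.orbit
        (Subgroup.closure {σ : Equiv.Perm ℕ | ∃ i, σ = Equiv.swap i (i + 1)}) 0 := by
      intro x
      induction x with
      | zero => exact MulAction.mem_orbit_self _
      | succ x ih =>
        obtain ⟨g, hg⟩ := ih
        refine ⟨⟨Equiv.swap x (x + 1), Subgroup.subset_closure ⟨x, rfl⟩⟩ * g, ?_⟩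
        change Equiv.swap x (x + 1) (g • 0) = x + 1
        have hg' : g • 0 = x := hg
        rw [hg', Equiv.swap_apply_left]
    rw [MulAction.orbit_eq_iff.mpr (horb x)]
    exact horb _
  clear hπ
  induction hmem using Subgroup.closure_induction with
  | mem x hx =>
    obtain ⟨i, rfl⟩ := hx
    exact ⟨rg m i, Phi_rg m i, by rw [parity_rg]⟩
  | one => exact ⟨1, by simp, by simp⟩
  | mul x y _ _ hx hy =>
    obtain ⟨a, ha, ha'⟩ := hx
    obtain ⟨b, hb, hb'⟩ := hy
    exact ⟨a * b, by rw [map_mul, map_mul, ha, hb], by rw [map_mul, Prod.snd_mul, ha', hb', one_mul]⟩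
  | inv x _ hx =>
    obtain ⟨a, ha, ha'⟩ := hx
    exact ⟨a⁻¹, by rw [map_inv, map_inv, ha], by rw [parity_inv, ha']⟩

open Classical in
/-- The involution that exchanges `j` and `j + s` for `j ∈ A`. -/
noncomputable def shiftPerm (A : Set ℕ) (s : ℕ) (hA : A ⊆ Set.Iio s) : Equiv.Perm ℕ :=
  Function.Involutive.toPerm
    (fun j => if j ∈ A then j + s else if s ≤ j ∧ j - s ∈ A then j - s else j) (by
      intro j
      have hA' : ∀ i ∈ A, i < s := hA
      by_cases h1 : j ∈ A
      · have h2 : j + s ∉ A := fun h => by have := hA' _ h; omega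
        simp [h1, h2]
      · by_cases h2 : s ≤ j ∧ j - s ∈ A
        · simp [h1, h2]
        · simp [h1, h2])

open Classical in
theorem shiftPerm_apply_mem {A : Set ℕ} {s : ℕ} (hA : A ⊆ Set.Iio s) {j : ℕ} (hj : j ∈ A) :
    shiftPerm A s hA j = j + s := by
  change (if _ then _ else _) = _
  rw [if_pos hj]

open Classical in
theorem shiftPerm_apply_of_notMem {A : Set ℕ} {s : ℕ} (hA : A ⊆ Set.Iio s) {j : ℕ} (hj : j ∉ A)
    (h : j < s ∨ s + s ≤ j) : shiftPerm A s hA j = j := by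
  change (if _ then _ else _) = _
  rw [if_neg hj, if_neg]
  rintro ⟨h1, h2⟩
  have : j - s < s := hA h2
  omega

/-- Elements of even parity that move a finite set `A` away, and otherwise only points that
are not below `s`. -/
theorem exists_shift (hm : Even m) {A : Set ℕ} {s : ℕ} (hA : A ⊆ Set.Iio s) :
    ∃ (c : GInf' m) (π : Equiv.Perm ℕ), Phi m c = SemidirectProduct.inr π ∧ parity hm c = 1 ∧
      (∀ j ∈ A, π j = j + s) ∧ ∀ j ∈ supp c, j ∈ A ∨ s ≤ j := by
  have hfin : {j | shiftPerm A s hA j ≠ j}.Finite := by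
    refine (Set.finite_Iio (s + s)).subset fun j hj => ?_
    by_contra h
    have hjA : j ∉ A := fun h' => by
      have := hA h'
      simp only [Set.mem_Iio] at *
      omega
    exact hj (shiftPerm_apply_of_notMem hA hjA (Or.inr (by simpa using h)))
  obtain ⟨c, hc, hc2⟩ := exists_lift_of_finite hm hfin
  have hsupp : ∀ j ∈ supp c, j ∈ A ∨ s ≤ j := by
    intro j hj
    by_contra! h
    refine notMem_supp.mpr ?_ hj
    rw [hc]
    exact ⟨rfl, shiftPerm_apply_of_notMem hA h.1 (Or.inl h.2)⟩
  rcases Int.units_eq_one_or (parity hm c).1 with h1 | h1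
  · exact ⟨c, _, hc, Prod.ext h1 hc2, fun j hj => shiftPerm_apply_mem hA hj, hsupp⟩
  -- A transposition of two points from `2 * s` on, which the shift leaves fixed, corrects the sign.
  · refine ⟨c * rg m (s + s), shiftPerm A s hA * Equiv.swap (s + s) (s + s + 1), ?_, ?_, ?_, ?_⟩
    · rw [map_mul, hc, Phi_rg, ← map_mul]
    · rw [map_mul, parity_rg]
      exact Prod.ext (by simp [h1]) (by simp [hc2])
    · intro j hj
      have := hA hj
      simp only [Set.mem_Iio] at this
      rw [Equiv.Perm.mul_apply, Equiv.swap_apply_of_ne_of_ne (by omega) (by omega),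
        shiftPerm_apply_mem hA hj]
    · intro j hj
      by_contra h
      refine notMem_supp_mul (fun h' => h (hsupp j h')) (fun h' => ?_) hj
      have := supp_rg_subset _ h'
      simp only [Set.mem_insert_iff, Set.mem_singleton_iff] at this
      omega

/-! ### Commutation of elements with disjoint supports -/

theorem supp_conj_subset {c g : GInf' m} {A : Set ℕ} (hg : supp g ⊆ A)
    (hc : ∀ j ∈ A, (Phi m c).right j ∈ A) : supp (c * g * c⁻¹) ⊆ A := by
  intro j hj
  obtain ⟨i, hi, rfl⟩ := exists_of_mem_supp_conj hj
  exact hc i (hg hi)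

theorem right_apply_of_notMem_supp {c : GInf' m} {j : ℕ} (h : j ∉ supp c) :
    (Phi m c).right j = j := (notMem_supp.mp h).2

/-- Only supports in an initial segment are known to give words in generators. So the points below
`n` are moved beyond the support of `k`: the generators of `below m n` become, up to `Z`, generators
with large index, and the conjugate of `k` becomes a word in generators of small index. The defining
relations then apply. -/
theorem parityCommute_of_below (hm : Even m) {n : ℕ} {h k : GInf' m} (hh : h ∈ below m n)
    (hk : supp k ⊆ Set.Ici n) : ParityCommute hm h k := by
  obtain ⟨N₀, hN₀⟩ := supp_finite_bound k
  obtain ⟨N, hN, hnN⟩ : ∃ N, supp k ⊆ Set.Iio N ∧ n ≤ N :=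
    ⟨max N₀ n, hN₀.trans (Set.Iio_subset_Iio (le_max_left _ _)), le_max_right _ _⟩
  obtain ⟨c, π, hc, -, hπ, hcs⟩ := exists_shift hm (Set.Iio_subset_Iio hnN)
  have hck : supp (c * k * c⁻¹) ⊆ Set.Iio N := by
    refine (supp_conj_subset (A := supp k) subset_rfl fun j hj => ?_).trans hN
    rw [right_apply_of_notMem_supp]
    · exact hj
    · intro hj'
      have h1 := hk hj
      have h2 := hN hj
      have h3 := hcs j hj'
      simp only [Set.mem_Iio, Set.mem_Ici] at *
      omega
  obtain ⟨z, hz, k', hk', e⟩ := exists_mul_below_of_supp hck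
  suffices hle : below m n ≤ parityCentralizer hm k from hle hh
  rw [below, belowSubgroup, Subgroup.closure_le]
  rintro x (⟨i, hi, rfl⟩ | ⟨i, hi, rfl⟩)
  · refine ParityCommute.of_conj c ?_
    have e' : Phi m (c * rg m i * c⁻¹) = Phi m (rg m (i + N)) := by
      rw [map_mul, map_mul, map_inv, hc, Phi_rg, Phi_rg, ← map_inv, ← map_mul, ← map_mul,
        ← Equiv.swap_apply_apply, hπ i (Set.mem_Iio.mpr (by omega)), hπ (i + 1) hi]
      congr 2; omega
    obtain ⟨z', hz', e'⟩ := exists_zSubgroup_mul_of_Phi_eq e'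
    rw [e, e']
    refine ParityCommute.of_zSubgroup_mul_right hz ?_
    refine (ParityCommute.of_zSubgroup_mul_right hz' ?_).symm
    exact below_le_parityCentralizer_rg (by omega) hk'
  · refine ParityCommute.of_conj c ?_
    have e' : Phi m (c * eg m i * c⁻¹) = Phi m (eg m (i + N)) := by
      rw [map_mul, map_mul, map_inv, hc, Phi_eg, Phi_eg, ← map_inv, ← SemidirectProduct.inl_aut]
      congr 1
      funext x
      change (Pi.mulSingle i (Multiplicative.ofAdd 1) : ℕ → Multiplicative (ZMod m)) (π⁻¹ x) = _
      simp only [Pi.mulSingle_apply, Equiv.Perm.inv_eq_iff_eq, hπ i hi]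
    obtain ⟨z', hz', e'⟩ := exists_zSubgroup_mul_of_Phi_eq e'
    rw [e, e']
    refine ParityCommute.of_zSubgroup_mul_right hz ?_
    refine (ParityCommute.of_zSubgroup_mul_right hz' ?_).symm
    exact below_le_parityCentralizer_eg (by omega) hk'

/-- Conjugation moves the support of `k` beyond all of `supp h` and keeps `supp h` in place, which
reduces to separated supports. -/
theorem parityCommute_of_disjoint (hm : Even m) {h k : GInf' m}
    (hd : Disjoint (supp h) (supp k)) : ParityCommute hm h k := by
  obtain ⟨N₁, hN₁⟩ := supp_finite_bound h
  obtain ⟨N₂, hN₂⟩ := supp_finite_bound k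
  obtain ⟨N, hN, hN'⟩ : ∃ N, supp h ⊆ Set.Iio N ∧ supp k ⊆ Set.Iio N :=
    ⟨max N₁ N₂, hN₁.trans (Set.Iio_subset_Iio (le_max_left _ _)),
      hN₂.trans (Set.Iio_subset_Iio (le_max_right _ _))⟩
  obtain ⟨c, π, hc, -, hπ, hcs⟩ := exists_shift hm hN'
  refine ParityCommute.of_conj c ?_
  have hch : supp (c * h * c⁻¹) ⊆ Set.Iio N := by
    refine (supp_conj_subset (A := supp h) subset_rfl fun j hj => ?_).trans hN
    rw [right_apply_of_notMem_supp]
    · exact hj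
    · intro hj'
      have h2 : j < N := hN hj
      rcases hcs j hj' with h3 | h3
      · exact Set.disjoint_left.mp hd hj h3
      · omega
  obtain ⟨z, hz, h', hh', e⟩ := exists_mul_below_of_supp hch
  rw [e]
  refine (ParityCommute.of_zSubgroup_mul_right hz (parityCommute_of_below hm hh' ?_).symm).symm
  intro j hj
  obtain ⟨i, hi, rfl⟩ := exists_of_mem_supp_conj hj
  rw [hc, SemidirectProduct.right_inr, hπ i hi]
  simp

/-- If `h` and `k` have disjoint supports, then `h` has infinitely many conjugates with pairwise
disjoint supports running to infinity, by elements that commute with `k`. -/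
theorem exists_disjoint_conjugates (hm : Even m) {h k : GInf' m}
    (hd : Disjoint (supp h) (supp k)) :
    ∃ x : ℕ → GInf' m, (∀ i, ∃ c, x i = c * h * c⁻¹ ∧ Commute c k) ∧
      (∀ i j, i ≠ j → Disjoint (supp (x i)) (supp (x j))) ∧
      ∀ n, ∃ i₀, ∀ i, i₀ ≤ i → supp (x i) ⊆ Set.Ici n := by
  obtain ⟨N₁, hN₁⟩ := supp_finite_bound h
  obtain ⟨N₂, hN₂⟩ := supp_finite_bound k
  -- The `i`-th shift by `N * (i + 1)` puts the support into the block `[N(i+1), N(i+2))`;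
  -- positivity of `N` makes the blocks escape to infinity.
  obtain ⟨N, hN, hN', hpos⟩ : ∃ N, supp h ⊆ Set.Iio N ∧ supp k ⊆ Set.Iio N ∧ 0 < N :=
    ⟨N₁ + N₂ + 1, hN₁.trans (Set.Iio_subset_Iio (by omega)),
      hN₂.trans (Set.Iio_subset_Iio (by omega)), by omega⟩
  have hsub : ∀ i : ℕ, supp h ⊆ Set.Iio (N * (i + 1)) := fun i =>
    hN.trans (Set.Iio_subset_Iio (Nat.le_mul_of_pos_right _ (by omega)))
  choose c π hc hcp hπ hcs using fun i => exists_shift hm (hsub i)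
  have hx : ∀ i, ∀ j ∈ supp (c i * h * (c i)⁻¹), N * (i + 1) ≤ j ∧ j < N * (i + 2) := by
    intro i j hj
    obtain ⟨a, ha, rfl⟩ := exists_of_mem_supp_conj hj
    rw [hc, SemidirectProduct.right_inr, hπ i a ha]
    have := hN ha
    simp only [Set.mem_Iio] at this
    constructor <;> nlinarith
  refine ⟨fun i => c i * h * (c i)⁻¹, fun i => ⟨c i, rfl, ?_⟩, fun i j hij => ?_, fun n =>
    ⟨n, fun i hi j hj => ?_⟩⟩
  · have hdis : Disjoint (supp (c i)) (supp k) := by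
      refine Set.disjoint_left.mpr fun j hj hjk => ?_
      rcases hcs i j hj with h1 | h1
      · exact Set.disjoint_left.mp hd h1 hjk
      · have : j < N := hN' hjk
        nlinarith
    have := parityCommute_of_disjoint hm hdis
    rw [ParityCommute, hcp, eps_one_left, Subgroup.coe_one, one_mul] at this
    exact this
  · refine Set.disjoint_left.mpr fun a ha hb => ?_
    have h1 := hx i a ha
    have h2 := hx j a hb
    rcases Nat.lt_or_gt_of_ne hij with h | h
    · have : N * (i + 2) ≤ N * (j + 1) := Nat.mul_le_mul_left _ (by omega)
      omega
    · have : N * (j + 2) ≤ N * (i + 1) := Nat.mul_le_mul_left _ (by omega)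
      omega
  · have := (hx i j hj).1
    simp only [Set.mem_Ici]
    nlinarith

/-! ### The product of the first `n` generators `η̂_j` -/

variable (m) in
/-- `η̂_0 η̂_1 ⋯ η̂_{n-1}`. -/
def etaProd : ℕ → GInf' m
  | 0 => 1
  | n + 1 => etaProd n * eg m n

theorem etaProd_mem_below (n : ℕ) : etaProd m n ∈ below m n := by
  induction n with
  | zero => exact one_mem _
  | succ n ih =>
    exact mul_mem (belowSubgroup_mono _ _ (by omega) ih) (H_mem_belowSubgroup _ _ (by omega))

theorem parity_etaProd (hm : Even m) (n : ℕ) : parity hm (etaProd m n) = (1, (-1) ^ n) := by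
  induction n with
  | zero => simp [etaProd]; rfl
  | succ n ih => rw [etaProd, map_mul, ih, parity_eg, pow_succ]; rfl

/-- The factor `η̂_j` contributes no sign and each of the other `n - 1` factors contributes `z₂`; `n
+ 1` has the same parity as `n - 1`. -/
theorem eg_etaProd {j n : ℕ} (h : j < n) :
    eg m j * etaProd m n = zc m 1 ^ (n + 1) * (etaProd m n * eg m j) := by
  have far : ∀ n, n ≤ j → eg m j * etaProd m n = zc m 1 ^ n * (etaProd m n * eg m j) := by
    intro n
    induction n with
    | zero => intro _; simp [etaProd]
    | succ n ih =>
      intro hn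
      rw [etaProd, ← mul_assoc, ih (by omega), mul_assoc, mul_assoc, eg_comm m (by omega : j ≠ n),
        ← mul_assoc (etaProd m n), ← (zc_comm m 1 _).eq, pow_succ]
      simp only [mul_assoc]
  induction n with
  | zero => omega
  | succ n ih =>
    rcases (Nat.lt_succ_iff.mp h).eq_or_lt with rfl | h
    · rw [etaProd, ← mul_assoc, far j le_rfl, pow_succ, pow_succ,
        mul_assoc (zc m 1 ^ j) (zc m 1), zc_sq, mul_one]
      simp only [mul_assoc]
    · rw [etaProd, ← mul_assoc, ih h, mul_assoc, mul_assoc, eg_comm m (by omega : j ≠ n),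
        ← mul_assoc (etaProd m n), ← (zc_comm m 1 _).eq, pow_succ _ (n + 1)]
      simp only [mul_assoc]

/-- Each of the `n` factors contributes `z₃`; restoring the order of the interchanged factors
`η̂_i`, `η̂_{i+1}` costs one `z₂`. -/
theorem rg_etaProd {i n : ℕ} (h : i + 1 < n) :
    rg m i * etaProd m n = zc m 2 ^ n * zc m 1 * (etaProd m n * rg m i) := by
  have far : ∀ n, n ≤ i → rg m i * etaProd m n = zc m 2 ^ n * (etaProd m n * rg m i) := by
    intro n
    induction n with
    | zero => intro _; simp [etaProd]
    | succ n ih =>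
      intro hn
      rw [etaProd, ← mul_assoc, ih (by omega), mul_assoc, mul_assoc, rg_eg,
        Equiv.swap_apply_of_ne_of_ne (by omega) (by omega),
        ← mul_assoc (etaProd m n), ← (zc_comm m 2 _).eq, pow_succ]
      simp only [mul_assoc]
  have hz : ∀ (k : Fin 3) (g x : GInf' m), g * (zc m k * x) = zc m k * (g * x) := fun k g x => by
    rw [← mul_assoc, ← (zc_comm m k g).eq, mul_assoc]
  induction n with
  | zero => omega
  | succ n ih =>
    rcases (Nat.lt_succ_iff.mp h).eq_or_lt with rfl | h
    · have h1 : rg m i * eg m i = zc m 2 * (eg m (i + 1) * rg m i) := by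
        rw [rg_eg, Equiv.swap_apply_left]
      have h2 : rg m i * eg m (i + 1) = zc m 2 * (eg m i * rg m i) := by
        rw [rg_eg, Equiv.swap_apply_right]
      rw [etaProd, etaProd]
      calc rg m i * (etaProd m i * eg m i * eg m (i + 1))
          = zc m 2 ^ i * (etaProd m i * ((rg m i * eg m i) * eg m (i + 1))) := by
            rw [mul_assoc, ← mul_assoc, far i le_rfl]; simp only [mul_assoc]
        _ = zc m 2 ^ i * (zc m 2 * (zc m 2 * (zc m 1 *
              (etaProd m i * eg m i * eg m (i + 1) * rg m i)))) := by
            rw [h1, mul_assoc (zc m 2), mul_assoc (eg m (i + 1)), h2, hz 2 (eg m (i + 1)),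
              ← mul_assoc (eg m (i + 1)), eg_comm m (by omega : i + 1 ≠ i)]
            simp only [mul_assoc, hz 2 (etaProd m i),
              hz 1 (etaProd m i)]
        _ = _ := by simp only [pow_succ, mul_assoc]
    · rw [etaProd, ← mul_assoc, ih h, mul_assoc, mul_assoc (etaProd m n), rg_eg,
        Equiv.swap_apply_of_ne_of_ne (by omega) (by omega), hz 2, pow_succ, mul_assoc _ (zc m 1),
        hz 2 (zc m 1)]
      simp only [mul_assoc]

/-- For even `n`, elements of the `n`-th subgroup commute with `η̂_0 ⋯ η̂_{n-1}` up to `z₂` to the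
total parity. -/
theorem below_etaProd (hm : Even m) {n : ℕ} (hn : Even n) {h : GInf' m} (hh : h ∈ below m n) :
    h * etaProd m n =
      zc m 1 ^ signExp ((parity hm h).1 * (parity hm h).2) (-1) * (etaProd m n * h) := by
  have pow_even : ∀ k, zc m k ^ n = 1 := fun k => by
    obtain ⟨q, rfl⟩ := hn
    rw [← two_mul, pow_mul, pow_two, zc_sq, one_pow]
  have hzc : ∀ (k : ℕ) (g x : GInf' m), g * (zc m 1 ^ k * x) = zc m 1 ^ k * (g * x) := fun k g x => by
    rw [← mul_assoc, ← ((zc_comm m 1 g).pow_left k).eq, mul_assoc]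
  have hsq : ∀ (k : ℕ) (x : GInf' m), zc m 1 ^ k * (zc m 1 ^ k * x) = x := fun k x => by
    rw [← mul_assoc, ← pow_add, ← two_mul, pow_mul, pow_two, zc_sq, one_pow, one_mul]
  induction hh using Subgroup.closure_induction with
  | mem x hx =>
    rcases hx with ⟨i, hi, rfl⟩ | ⟨i, hi, rfl⟩
    · rw [rg_etaProd hi, parity_rg, pow_even]; simp [signExp]
    · rw [eg_etaProd hi, parity_eg, pow_succ, pow_even]; simp [signExp]
  | one =>
    have h' : (1 : ℤˣ) ≠ -1 := by decide
    simp [signExp, h']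
  | mul x y _ _ hx hy =>
    rw [map_mul, Prod.fst_mul, Prod.snd_mul, mul_mul_mul_comm, pow_signExp_mul (zc_sq m 1),
      mul_assoc, hy, hzc, ← mul_assoc x, hx, mul_assoc _ _ (etaProd m n * (x * y))]
    simp only [mul_assoc]
    exact hzc _ _ _
  | inv x _ hx =>
    rw [parity_inv]
    have h1 : x⁻¹ * etaProd m n = x⁻¹ * (etaProd m n * x) * x⁻¹ := by group
    have h2 : etaProd m n * x =
        zc m 1 ^ signExp ((parity hm x).1 * (parity hm x).2) (-1) * (x * etaProd m n) := by
      rw [hx, hsq]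
    rw [h1, h2, hzc]
    group

end Comm

/-! ### Positive-definite functions on a group -/

section PosDef

open scoped ComplexOrder ComplexConjugate
open Filter Topology

variable {G : Type*} [Group G]

theorem IsPosDef.posSemidef {f : G → ℂ} (hf : IsPosDef f) {ι : Type*} [Fintype ι] (g : ι → G) :
    (Matrix.of fun i j => f ((g i)⁻¹ * g j)).PosSemidef := by
  have h := (hf (Fintype.card ι) (g ∘ (Fintype.equivFin ι).symm)).submatrix (Fintype.equivFin ι)
  convert h using 1
  ext i j
  simp

theorem IsPosDef.sum_nonneg {f : G → ℂ} (hf : IsPosDef f) {ι : Type*} [Fintype ι] (g : ι → G)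
    (c : ι → ℂ) : 0 ≤ ∑ i, ∑ j, conj (c i) * c j * f ((g i)⁻¹ * g j) := by
  have h := (hf.posSemidef g).dotProduct_mulVec_nonneg c
  convert h using 1
  simp only [dotProduct, Matrix.mulVec, Matrix.of_apply, Pi.star_apply, Finset.mul_sum]
  refine Finset.sum_congr rfl fun i _ => Finset.sum_congr rfl fun j _ => ?_
  simp only [RCLike.star_def]
  ring

theorem IsPosDef.map_inv {f : G → ℂ} (hf : IsPosDef f) (g : G) : f g⁻¹ = conj (f g) := by
  have h := (hf.posSemidef ![1, g]).isHermitian.apply 0 1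
  simpa using congrArg conj h

theorem isPosDef_of_sum_nonneg {f : G → ℂ} (hinv : ∀ g, f g⁻¹ = conj (f g))
    (h : ∀ (n : ℕ) (g : Fin n → G) (c : Fin n → ℂ),
      0 ≤ ∑ i, ∑ j, conj (c i) * c j * f ((g i)⁻¹ * g j)) : IsPosDef f := by
  intro n g
  refine Matrix.PosSemidef.of_dotProduct_mulVec_nonneg ?_ fun c => ?_
  · ext i j
    simp only [Matrix.conjTranspose_apply, Matrix.of_apply, RCLike.star_def]
    rw [← hinv, mul_inv_rev, inv_inv]
  · convert h n g c using 1
    simp only [dotProduct, Matrix.mulVec, Matrix.of_apply, Pi.star_apply, Finset.mul_sum]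
    refine Finset.sum_congr rfl fun i _ => Finset.sum_congr rfl fun j _ => ?_
    simp only [RCLike.star_def]
    ring

theorem IsPosDef.one_nonneg {f : G → ℂ} (hf : IsPosDef f) : 0 ≤ f 1 := by
  simpa using hf.sum_nonneg (fun _ : Unit => 1) (fun _ => 1)

theorem IsPosDef.norm_le {f : G → ℂ} (hf : IsPosDef f) (g : G) : ‖f g‖ ≤ (f 1).re := by
  -- The phase `u` makes the off-diagonal terms of the form on `1`, `g` equal to `-‖f g‖`.
  obtain ⟨u, hu, hu'⟩ : ∃ u : ℂ, conj u * u = 1 ∧ u * f g = -(‖f g‖ : ℂ) := by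
    by_cases h : f g = 0
    · exact ⟨1, by simp, by simp [h]⟩
    · have h0 : (‖f g‖ : ℂ) ≠ 0 := by simpa using h
      have hn : conj (f g) * f g = (‖f g‖ : ℂ) ^ 2 := Complex.conj_mul' _
      refine ⟨-(conj (f g) / ‖f g‖), ?_, ?_⟩
      · simp only [map_neg, map_div₀, Complex.conj_conj, Complex.conj_ofReal]
        field_simp
        rw [mul_comm, hn]
      · rw [neg_mul, div_mul_eq_mul_div, hn, pow_two, mul_div_cancel_right₀ _ h0]
  have h := hf.sum_nonneg ![1, g] ![1, u]
  simp only [Fin.sum_univ_two, Matrix.cons_val_zero, Matrix.cons_val_one, map_one, one_mul,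
    inv_one, mul_one, inv_mul_cancel, hu, hu'] at h
  rw [hf.map_inv, ← map_mul, hu'] at h
  simp only [map_neg, Complex.conj_ofReal] at h
  have := (Complex.le_def.mp h).1
  simp at this
  linarith

/-- Cauchy–Schwarz for averages over finitely many group elements. -/
theorem IsPosDef.norm_sum_sq_le {f : G → ℂ} (hf : IsPosDef f) (h1 : f 1 = 1) {ι : Type*}
    [Fintype ι] (x : ι → G) : ‖∑ i, f (x i)‖ ^ 2 ≤ (∑ i, ∑ j, f ((x i)⁻¹ * x j)).re := by
  set s := ∑ i, f (x i) with hs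
  -- Positivity for the sum of the vectors at `x i` minus its projection onto the vector at the
  -- identity.
  have h := hf.sum_nonneg (Option.elim · 1 x) (Option.elim · (-s) fun _ => (1 : ℂ))
  simp only [Fintype.sum_option, Option.elim_none, Option.elim_some, inv_one, one_mul, mul_one,
    map_one, map_neg, h1, Finset.sum_add_distrib, ← Finset.mul_sum, hf.map_inv] at h
  rw [← map_sum, ← hs] at h
  have hn : conj s * s = (‖s‖ : ℂ) ^ 2 := Complex.conj_mul' _
  have e : -conj s * -s + -s * conj s + (-conj s * s + ∑ i, ∑ j, f ((x i)⁻¹ * x j)) =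
      ∑ i, ∑ j, f ((x i)⁻¹ * x j) - (‖s‖ : ℂ) ^ 2 := by rw [← hn]; ring
  rw [e, ← Complex.ofReal_pow] at h
  have := (Complex.le_def.mp h).1
  simp only [Complex.zero_re, Complex.sub_re, Complex.ofReal_re] at this
  linarith

theorem IsPosDef.mul {f₁ f₂ : G → ℂ} (h₁ : IsPosDef f₁) (h₂ : IsPosDef f₂) :
    IsPosDef (f₁ * f₂) := fun n g => (h₁ n g).hadamard (h₂ n g)

theorem K1_mul {f₁ f₂ : G → ℂ} (h₁ : f₁ ∈ K1 G) (h₂ : f₂ ∈ K1 G) : f₁ * f₂ ∈ K1 G :=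
  ⟨h₁.1.mul h₂.1, fun g h => by simp [h₁.2.1, h₂.2.1], by simp [h₁.2.2, h₂.2.2]⟩

theorem K1_mul_comm {f : G → ℂ} (hf : f ∈ K1 G) (g h : G) : f (g * h) = f (h * g) := by
  have := hf.2.1 (h * g) g
  rw [← this]; group

/-! ### Averaging over conjugates, and extremality -/

/-- Summing over `N` elements whose pairwise quotients have the same value `q`. -/
theorem sum_quotients {f : G → ℂ} (h1 : f 1 = 1) {x : ℕ → G} {q : ℂ}
    (hq : ∀ i j, i ≠ j → f ((x i)⁻¹ * x j) = q) (N : ℕ) :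
    ∑ i : Fin N, ∑ j : Fin N, f ((x i)⁻¹ * x j) = N * (1 - q) + (N : ℂ) ^ 2 * q := by
  have : ∀ i j : Fin N, f ((x i)⁻¹ * x j) = (if i = j then 1 - q else 0) + q := by
    intro i j
    split_ifs with h
    · subst h; simp [h1]
    · rw [hq _ _ (fun h' => h (Fin.ext h'))]; simp
  simp only [this, Finset.sum_add_distrib, Finset.sum_ite_eq, Finset.mem_univ, if_true,
    Finset.sum_const, Finset.card_univ, Fintype.card_fin, nsmul_eq_mul]
  ring

/-- Infinitely many orthonormal vectors cannot all have the same nonzero inner product with a fixed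
vector: Cauchy–Schwarz gives `N² |p|² ≤ N` for all `N`. -/
theorem eq_zero_of_orthogonal {f : G → ℂ} (hf : IsPosDef f) (h1 : f 1 = 1) {x : ℕ → G} {p : ℂ}
    (hp : ∀ i, f (x i) = p) (hq : ∀ i j, i ≠ j → f ((x i)⁻¹ * x j) = 0) : p = 0 := by
  by_contra hne
  have hpos : 0 < ‖p‖ ^ 2 := by positivity
  obtain ⟨N, hN⟩ := exists_nat_gt (1 / ‖p‖ ^ 2)
  have h := hf.norm_sum_sq_le h1 (fun i : Fin N => x i)
  simp only [hp, Finset.sum_const, Finset.card_univ, Fintype.card_fin, nsmul_eq_mul,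
    sum_quotients h1 hq, norm_mul, Complex.norm_natCast, sub_zero, mul_one, mul_zero, add_zero,
    Complex.natCast_re] at h
  rw [div_lt_iff₀ hpos] at hN
  have hNpos : (0 : ℝ) < N := by
    rcases Nat.eq_zero_or_pos N with rfl | h
    · simp at hN; linarith
    · exact_mod_cast h
  nlinarith

/-- A function `f` in `K₁(G)` is a character if every `h` has a sequence of conjugates whose pairwise
quotients all have the value `|f h|²`. -/
theorem mem_E_of_conjugates {f : G → ℂ} (hf : f ∈ K1 G)
    (hx : ∀ h : G, ∃ x : ℕ → G, (∀ i, ∃ c, x i = c * h * c⁻¹) ∧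
      ∀ i j, i ≠ j → f ((x i)⁻¹ * x j) = conj (f h) * f h) : f ∈ E G := by
  refine mem_extremePoints_iff_left.mpr ⟨hf, ?_⟩
  rintro f₁ h₁ f₂ h₂ ⟨a, b, ha, hb, hab, rfl⟩
  set f := a • f₁ + b • f₂ with hfdef
  have hval : ∀ g, f g = a * f₁ g + b * f₂ g := fun g => by simp [hfdef]
  funext h
  obtain ⟨x, hxc, hxq⟩ := hx h
  have hconst : ∀ {f' : G → ℂ}, f' ∈ K1 G → ∀ i, f' (x i) = f' h := by
    intro f' hf' i
    obtain ⟨c, hc⟩ := hxc i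
    rw [hc, hf'.2.1]
  have hconj : conj (f h) * f h = ((‖f h‖ ^ 2 : ℝ) : ℂ) := by
    rw [Complex.conj_mul']; norm_cast
  have key : ∀ N : ℕ, (N : ℝ) ^ 2 * (a * ‖f₁ h‖ ^ 2 + b * ‖f₂ h‖ ^ 2) ≤
      N * (1 - ‖f h‖ ^ 2) + (N : ℝ) ^ 2 * ‖f h‖ ^ 2 := by
    intro N
    have b1 := h₁.1.norm_sum_sq_le h₁.2.2 (fun i : Fin N => x i)
    have b2 := h₂.1.norm_sum_sq_le h₂.2.2 (fun i : Fin N => x i)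
    have e := congrArg Complex.re (sum_quotients hf.2.2 hxq N)
    simp only [hval, Finset.sum_add_distrib, ← Finset.mul_sum] at e
    rw [Complex.add_re, Complex.re_ofReal_mul, Complex.re_ofReal_mul, ← hval, hconj] at e
    have e' : ((N : ℂ) * (1 - ((‖f h‖ ^ 2 : ℝ) : ℂ)) +
        (N : ℂ) ^ 2 * ((‖f h‖ ^ 2 : ℝ) : ℂ)).re =
        N * (1 - ‖f h‖ ^ 2) + (N : ℝ) ^ 2 * ‖f h‖ ^ 2 := by
      rw [← Complex.ofReal_re ((N : ℝ) * (1 - ‖f h‖ ^ 2) + (N : ℝ) ^ 2 * ‖f h‖ ^ 2)]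
      congr 1; push_cast; ring
    rw [e'] at e
    simp only [hconst h₁, hconst h₂, Finset.sum_const, Finset.card_univ, Fintype.card_fin,
      nsmul_eq_mul, norm_mul, Complex.norm_natCast] at b1 b2
    rw [← e]
    nlinarith
  -- The `N²` terms of `key` give `a|f₁|² + b|f₂|² ≤ |f|²` at `h` in the limit; the defect of
  -- convexity of the squared modulus makes `f₁` and `f₂` agree there.
  have hdiff : a * ‖f₁ h‖ ^ 2 + b * ‖f₂ h‖ ^ 2 - ‖f h‖ ^ 2 = a * b * ‖f₁ h - f₂ h‖ ^ 2 := by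
    have hb' : b = 1 - a := by linarith
    rw [hval]
    simp only [← Complex.normSq_eq_norm_sq, Complex.normSq_apply, Complex.add_re, Complex.add_im,
      Complex.re_ofReal_mul, Complex.im_ofReal_mul, Complex.sub_re, Complex.sub_im]
    subst hb'; ring
  have hzero : ‖f₁ h - f₂ h‖ ^ 2 ≤ 0 := by
    by_contra! hpos
    obtain ⟨N, hN⟩ := exists_nat_gt (1 / (a * b * ‖f₁ h - f₂ h‖ ^ 2))
    have hpos' : 0 < a * b * ‖f₁ h - f₂ h‖ ^ 2 := by positivity
    have hNpos : (0 : ℝ) < N := lt_trans (by positivity) hN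
    rw [div_lt_iff₀ hpos', ← hdiff] at hN
    have h1 := key N
    have h2 : 0 ≤ ‖f h‖ ^ 2 := by positivity
    nlinarith
  have heq : f₁ h = f₂ h := by
    have : ‖f₁ h - f₂ h‖ = 0 := by nlinarith [norm_nonneg (f₁ h - f₂ h)]
    exact sub_eq_zero.mp (norm_eq_zero.mp this)
  rw [hval, ← heq, ← add_mul, ← Complex.ofReal_add, hab, Complex.ofReal_one, one_mul]

/-- A decomposition of a character into positive-definite central functions is trivial. -/
theorem eq_smul_of_mem_E {f ψ₁ ψ₂ : G → ℂ} (hf : f ∈ E G) (h₁ : IsPosDef ψ₁)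
    (c₁ : ∀ g h, ψ₁ (h * g * h⁻¹) = ψ₁ g) (h₂ : IsPosDef ψ₂)
    (c₂ : ∀ g h, ψ₂ (h * g * h⁻¹) = ψ₂ g) (hsum : ∀ g, f g = ψ₁ g + ψ₂ g) (g : G) :
    ψ₁ g = ψ₁ 1 * f g := by
  obtain ⟨hK, hext⟩ := mem_extremePoints_iff_left.mp hf
  have real : ∀ {ψ : G → ℂ}, IsPosDef ψ → ψ 1 = ((ψ 1).re : ℂ) ∧ 0 ≤ (ψ 1).re := by
    intro ψ hψ
    have := Complex.le_def.mp hψ.one_nonneg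
    exact ⟨Complex.ext rfl (by simpa using this.2.symm), this.1⟩
  have zero : ∀ {ψ : G → ℂ}, IsPosDef ψ → (ψ 1).re = 0 → ∀ g, ψ g = 0 := by
    intro ψ hψ h0 g
    have := hψ.norm_le g
    rw [h0] at this
    exact norm_le_zero_iff.mp this
  obtain ⟨r₁, n₁⟩ := real h₁
  obtain ⟨r₂, n₂⟩ := real h₂
  have hone : (ψ₁ 1).re + (ψ₂ 1).re = 1 := by
    have := congrArg Complex.re (hsum 1)
    rw [hK.2.2] at this
    simpa using this.symm
  have scaled : ∀ {ψ : G → ℂ}, IsPosDef ψ → (∀ g h, ψ (h * g * h⁻¹) = ψ g) → 0 < (ψ 1).re →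
      (fun g => (((ψ 1).re⁻¹ : ℝ) : ℂ) * ψ g) ∈ K1 G := by
    intro ψ hψ hc hpos
    refine ⟨fun n x => ?_, fun g h => by simp only [hc], ?_⟩
    · have : (0 : ℂ) ≤ (((ψ 1).re⁻¹ : ℝ) : ℂ) := by
        rw [Complex.zero_le_real]; positivity
      exact (hψ n x).smul this
    · have h0 : ((ψ 1).re : ℂ) ≠ 0 := by exact_mod_cast hpos.ne'
      change (((ψ 1).re⁻¹ : ℝ) : ℂ) * ψ 1 = 1
      rw [Complex.ofReal_inv, inv_mul_eq_one₀ h0]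
      exact (real hψ).1.symm
  rcases n₁.eq_or_lt with p₁ | p₁
  · rw [zero h₁ p₁.symm, r₁, ← p₁]; simp
  rcases n₂.eq_or_lt with p₂ | p₂
  · have h1 : (ψ₁ 1).re = 1 := by linarith
    rw [hsum, zero h₂ p₂.symm, r₁, h1]; simp
  have h := hext _ (scaled h₁ c₁ p₁) _ (scaled h₂ c₂ p₂) ⟨(ψ₁ 1).re, (ψ₂ 1).re, p₁, p₂, hone, by
    funext g
    have h1 : ((ψ₁ 1).re : ℂ) ≠ 0 := by exact_mod_cast p₁.ne'
    have h2 : ((ψ₂ 1).re : ℂ) ≠ 0 := by exact_mod_cast p₂.ne'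
    simp only [Pi.add_apply, Pi.smul_apply, Complex.real_smul, Complex.ofReal_inv]
    rw [mul_inv_cancel_left₀ h1, mul_inv_cancel_left₀ h2, hsum]⟩
  have h1 : ((ψ₁ 1).re : ℂ) ≠ 0 := by exact_mod_cast p₁.ne'
  rw [← congrFun h g, r₁]
  simp only [Complex.ofReal_inv, Complex.ofReal_re]
  rw [mul_inv_cancel_left₀ h1]

/-- If `u` commutes with `g` in the sense of `f`, then `f + Re (ε u f)` is positive on the
family `g`. -/
theorem IsPosDef.sum_twist_nonneg {f : G → ℂ} (hf : IsPosDef f) {u : G} {n : ℕ} {g : Fin n → G}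
    (hu : ∀ i j, f ((g i)⁻¹ * (u * g j)) = f (u * ((g i)⁻¹ * g j)))
    (hu' : ∀ i j, f ((g i)⁻¹ * (u⁻¹ * g j)) = f (u⁻¹ * ((g i)⁻¹ * g j)))
    {ε : ℂ} (hε : conj ε * ε = 1) (c : Fin n → ℂ) :
    0 ≤ ∑ i, ∑ j, conj (c i) * c j * ((1 / 2) * (f ((g i)⁻¹ * g j) +
      (1 / 2) * (ε * f (u * ((g i)⁻¹ * g j)) + conj ε * f (u⁻¹ * ((g i)⁻¹ * g j))))) := by
  -- Positivity for the vectors at `g i` and `u * g i` with coefficients `c i`, `ε * c i`: the two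
  -- diagonal blocks coincide, the others give the twist.
  have h := hf.sum_nonneg (Sum.elim g fun i => u * g i) (Sum.elim c fun i => ε * c i)
  have h4 : (0 : ℂ) ≤ 1 / 4 := by
    have : ((1 / 4 : ℝ) : ℂ) = 1 / 4 := by push_cast; rfl
    rw [← this, Complex.zero_le_real]; norm_num
  convert mul_nonneg h4 h using 1
  simp only [Fintype.sum_sum_type, Sum.elim_inl, Sum.elim_inr, ← Finset.sum_add_distrib,
    Finset.mul_sum]
  refine Finset.sum_congr rfl fun i _ => Finset.sum_congr rfl fun j _ => ?_
  have e1 : (u * g i)⁻¹ * g j = (g i)⁻¹ * (u⁻¹ * g j) := by group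
  have e2 : (u * g i)⁻¹ * (u * g j) = (g i)⁻¹ * g j := by group
  rw [e1, e2, hu, hu', map_mul]
  linear_combination (-(1 / 4) * conj (c i) * c j * f ((g i)⁻¹ * g j)) * hε

theorem IsPosDef.exists_ultrafilter_limit {f : G → ℂ} (hf : IsPosDef f) (U : Ultrafilter ℕ)
    (y : ℕ → G) : ∃ l, Tendsto (fun i => f (y i)) U (𝓝 l) := by
  have hK := isCompact_closedBall (0 : ℂ) (f 1).re
  obtain ⟨l, -, hl⟩ := hK.ultrafilter_le_nhds (U.map fun i => f (y i)) (by
    rw [le_principal_iff]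
    refine Filter.mem_map.mpr (Filter.Eventually.of_forall fun i => ?_)
    simpa using hf.norm_le (y i))
  exact ⟨l, hl⟩

/-- An asymptotically central sequence of elements acts as a scalar on a character. -/
theorem eq_mul_of_asymptotically_central {f : G → ℂ} (hf : f ∈ E G) {x : ℕ → G} {p q : ℂ} {k : G}
    (hx : ∀ g, ∀ᶠ i in atTop, ∀ a, f (g * (x i * a)) = f (x i * (g * a)))
    (hx' : ∀ g, ∀ᶠ i in atTop, ∀ a, f (g * ((x i)⁻¹ * a)) = f ((x i)⁻¹ * (g * a)))
    (hp : ∀ i, f (x i) = p) (hq : ∀ i, f (x i * k) = q) : q = p * f k := by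
  have hK : f ∈ K1 G := extremePoints_subset hf
  have hle : ((hyperfilter ℕ : Ultrafilter ℕ) : Filter ℕ) ≤ atTop := by
    rw [← Nat.cofinite_eq_atTop]; exact hyperfilter_le_cofinite
  -- A nonprincipal ultrafilter gives limits for all `g` at once, with no passage to subsequences.
  choose φ hφ using fun g => hK.1.exists_ultrafilter_limit (hyperfilter ℕ) fun i => x i * g
  choose φ' hφ' using fun g => hK.1.exists_ultrafilter_limit (hyperfilter ℕ) fun i => (x i)⁻¹ * g
  have hφinv : ∀ g, φ' g⁻¹ = conj (φ g) := by
    intro g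
    refine tendsto_nhds_unique (hφ' g⁻¹) ?_
    refine ((Complex.continuous_conj.tendsto _).comp (hφ g)).congr fun i => ?_
    change conj (f (x i * g)) = _
    rw [← hK.1.map_inv, mul_inv_rev, K1_mul_comm hK]
  have hcen : ∀ g h, φ (h * g * h⁻¹) = φ g := by
    intro g h
    refine tendsto_nhds_unique (hφ _) ((hφ g).congr' ?_)
    filter_upwards [hle (hx h)] with i hi
    have := hi (g * h⁻¹)
    rw [mul_assoc, ← this, ← hK.2.1 _ h]
    group
  have hcen' : ∀ g h, φ' (h * g * h⁻¹) = φ' g := by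
    intro g h
    refine tendsto_nhds_unique (hφ' _) ((hφ' g).congr' ?_)
    filter_upwards [hle (hx' h)] with i hi
    have := hi (g * h⁻¹)
    rw [mul_assoc, ← this, ← hK.2.1 _ h]
    group
  -- Since `φ` itself need not be positive-definite, it is symmetrised with a phase and added to
  -- `f`. Then `ψ ε + ψ (-ε) = f`, so extremality makes each `ψ ε` a multiple of `f`.
  let ψ : ℂ → G → ℂ := fun ε g =>
    (1 / 2) * (f g + (1 / 2) * (ε * φ g + conj ε * φ' g))
  have hψ : ∀ ε : ℂ, conj ε * ε = 1 → IsPosDef (ψ ε) := by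
    intro ε hε
    refine isPosDef_of_sum_nonneg (fun g => ?_) fun n g c => ?_
    · have e1 := hφinv g
      have e2 : φ g⁻¹ = conj (φ' g) := by
        have := hφinv g⁻¹
        rw [inv_inv] at this
        rw [this, Complex.conj_conj]
      simp only [ψ, e1, e2, hK.1.map_inv, map_mul, map_add, Complex.conj_conj, map_div₀, map_one,
        map_ofNat]
      ring
    · have hlim : Tendsto (fun a => ∑ i, ∑ j, conj (c i) * c j * ((1 / 2) * (f ((g i)⁻¹ * g j) +
          (1 / 2) * (ε * f (x a * ((g i)⁻¹ * g j)) +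
            conj ε * f ((x a)⁻¹ * ((g i)⁻¹ * g j)))))) (hyperfilter ℕ)
          (𝓝 (∑ i, ∑ j, conj (c i) * c j * ψ ε ((g i)⁻¹ * g j))) := by
        refine tendsto_finsetSum _ fun i _ => tendsto_finsetSum _ fun j _ => ?_
        exact ((((hφ _).const_mul ε).add ((hφ' _).const_mul (conj ε))).const_mul
          (1 / 2)).const_add _ |>.const_mul (1 / 2) |>.const_mul _
      refine ge_of_tendsto hlim ?_
      have ev1 : ∀ᶠ a in atTop, ∀ i, ∀ b, f ((g i)⁻¹ * (x a * b)) = f (x a * ((g i)⁻¹ * b)) :=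
        eventually_all.mpr fun i => hx (g i)⁻¹
      have ev2 : ∀ᶠ a in atTop, ∀ i, ∀ b,
          f ((g i)⁻¹ * ((x a)⁻¹ * b)) = f ((x a)⁻¹ * ((g i)⁻¹ * b)) :=
        eventually_all.mpr fun i => hx' (g i)⁻¹
      filter_upwards [hle ev1, hle ev2] with a h1 h2
      exact hK.1.sum_twist_nonneg (fun i j => h1 i _) (fun i j => h2 i _) hε c
  have hψc : ∀ ε g h, ψ ε (h * g * h⁻¹) = ψ ε g := fun ε g h => by
    simp only [ψ, hK.2.1, hcen, hcen']
  have key : ∀ ε : ℂ, conj ε * ε = 1 →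
      ε * φ k + conj ε * φ' k = (ε * φ 1 + conj ε * φ' 1) * f k := by
    intro ε hε
    have h := eq_smul_of_mem_E hf (hψ ε hε) (hψc ε) (hψ (-ε) (by simpa using hε)) (hψc (-ε))
      (fun g => by simp only [ψ, map_neg]; ring) k
    simp only [ψ, hK.2.2] at h
    linear_combination 4 * h
  -- The phases `1` and `i` separate `φ` from `φ'`.
  have k1 := key 1 (by simp)
  have k2 := key Complex.I (by simp)
  simp only [map_one, one_mul, Complex.conj_I] at k1 k2
  have hmain : φ k = φ 1 * f k := by
    linear_combination (1 / 2) * k1 - (Complex.I / 2) * k2 +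
      (1 / 2) * (φ k - φ' k - (φ 1 - φ' 1) * f k) * Complex.I_sq
  have e1 : φ 1 = p := tendsto_nhds_unique (hφ 1) (by simp only [mul_one, hp]; exact tendsto_const_nhds)
  have e2 : φ k = q := tendsto_nhds_unique (hφ k) (by simp only [hq]; exact tendsto_const_nhds)
  rw [← e1, ← e2, hmain]

end PosDef

/-! ### Spin types and factorisability -/

section Spin

open Filter

variable {m : ℕ}

/-- The value of `χ` on the commutator of elements with disjoint supports and parities `p`, `q`. -/
def spinSign (β : Fin 3 → ℤˣ) (p q : ℤˣ × ℤˣ) : ℤˣ :=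
  β 0 ^ signExp p.1 q.1 * β 1 ^ signExp p.2 q.2 * β 2 ^ (signExp p.1 q.2 + signExp p.2 q.1)

theorem HasSpinType.map_eps_mul {f : GInf' m → ℂ} {β : Fin 3 → ℤˣ} (hf : HasSpinType f β)
    (p q : ℤˣ × ℤˣ) (g : GInf' m) :
    f ((eps m p q : GInf' m) * g) = ((spinSign β p q : ℤ) : ℂ) * f g :=
  hf _ _ _ g

theorem HasSpinType.map_comm {f : GInf' m → ℂ} {β : Fin 3 → ℤˣ} (hf : HasSpinType f β)
    {hm : Even m} {h k : GInf' m} (H : ParityCommute hm h k) (a : GInf' m) :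
    f (h * (k * a)) = ((spinSign β (parity hm h) (parity hm k) : ℤ) : ℂ) * f (k * (h * a)) := by
  rw [← mul_assoc, H, mul_assoc, hf.map_eps_mul, mul_assoc]

theorem K1_conj_mul {G : Type*} [Group G] {f : G → ℂ} (hf : f ∈ K1 G) {c k : G}
    (hc : Commute c k) (h : G) : f (c * h * c⁻¹ * k) = f (h * k) := by
  rw [← hf.2.1 (h * k) c]
  congr 1
  rw [mul_assoc _ c⁻¹, hc.inv_left.eq]
  simp only [mul_assoc]

/-- The conjugates of `h` running to infinity eventually commute with any given element in the sense
of `f`, so they act on the extremal `f` as the scalar `f h`; being made by elements commuting with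
`k`, they leave `f (h * k)` unchanged. -/
theorem map_mul_of_central_parity (hm : Even m) {f : GInf' m → ℂ} {β : Fin 3 → ℤˣ}
    (hf : f ∈ E (GInf' m)) (hβ : HasSpinType f β) {h k : GInf' m}
    (hs : ∀ q, spinSign β (parity hm h) q = 1) (hd : Disjoint (supp h) (supp k)) :
    f (h * k) = f h * f k := by
  have hK : f ∈ K1 (GInf' m) := extremePoints_subset hf
  obtain ⟨x, hx, -, hxn⟩ := exists_disjoint_conjugates hm hd
  have hpar : ∀ i, parity hm (x i) = parity hm h := fun i => by
    obtain ⟨c, hc, -⟩ := hx i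
    rw [hc, parity_conj]
  have hev : ∀ g : GInf' m, ∀ᶠ i in atTop, Disjoint (supp (x i)) (supp g) := by
    intro g
    obtain ⟨n, hn⟩ := supp_finite_bound g
    obtain ⟨i₀, hi₀⟩ := hxn n
    filter_upwards [eventually_ge_atTop i₀] with i hi
    exact Set.disjoint_left.mpr fun j hj hj' =>
      not_le.mpr (Set.mem_Iio.mp (hn hj')) (hi₀ i hi hj)
  refine eq_mul_of_asymptotically_central hf (x := x) (fun g => ?_) (fun g => ?_)
    (fun i => ?_) (fun i => ?_)
  · filter_upwards [hev g] with i hi a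
    rw [hβ.map_comm (parityCommute_of_disjoint hm hi), hpar, hs]
    simp
  · filter_upwards [hev g] with i hi a
    rw [← supp_inv] at hi
    rw [hβ.map_comm (parityCommute_of_disjoint hm hi), parity_inv, hpar, hs]
    simp
  · obtain ⟨c, hc, -⟩ := hx i
    rw [hc, hK.2.1]
  · obtain ⟨c, hc, hck⟩ := hx i
    rw [hc, K1_conj_mul hK hck]

/-- Centrality and anticommutation give `f ((x i)⁻¹ * x j) = -f ((x i)⁻¹ * x j)`. So the vectors at
`x i * k` are orthogonal, yet `f` has the same value at all of them. -/
theorem map_mul_eq_zero_of_anticommute (hm : Even m) {f : GInf' m → ℂ} {β : Fin 3 → ℤˣ}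
    (hK : f ∈ K1 (GInf' m)) (hβ : HasSpinType f β) {h k : GInf' m}
    (hs : spinSign β (parity hm h) (parity hm h) = -1) (hd : Disjoint (supp h) (supp k)) :
    f (h * k) = 0 := by
  obtain ⟨x, hx, hxd, -⟩ := exists_disjoint_conjugates hm hd
  have hpar : ∀ i, parity hm (x i) = parity hm h := fun i => by
    obtain ⟨c, hc, -⟩ := hx i
    rw [hc, parity_conj]
  refine eq_zero_of_orthogonal hK.1 hK.2.2 (x := fun i => x i * k) (fun i => ?_)
    (fun i j hij => ?_)
  · obtain ⟨c, hc, hck⟩ := hx i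
    rw [hc, K1_conj_mul hK hck]
  · have e : (x i * k)⁻¹ * (x j * k) = k⁻¹ * ((x i)⁻¹ * x j) * k⁻¹⁻¹ := by group
    rw [e, hK.2.1]
    have hd' : Disjoint (supp (x i)⁻¹) (supp (x j)) := by rw [supp_inv]; exact hxd i j hij
    have h1 := hβ.map_comm (parityCommute_of_disjoint hm hd') 1
    rw [parity_inv, hpar, hpar, hs, mul_one, mul_one, K1_mul_comm hK (x j)] at h1
    simp only [Units.val_neg, Units.val_one, Int.cast_neg, Int.cast_one, neg_mul, one_mul] at h1
    exact self_eq_neg.mp h1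

theorem map_mul_eq_zero_of_odd (hm : Even m) {f : GInf' m → ℂ} {β : Fin 3 → ℤˣ}
    (hK : f ∈ K1 (GInf' m)) (hβ : HasSpinType f β) {h k : GInf' m} (hβ1 : β 1 = -1)
    (hs : (parity hm h).1 * (parity hm h).2 = -1) (hd : Disjoint (supp h) (supp k)) :
    f (h * k) = 0 := by
  obtain ⟨x, hx, -, hxn⟩ := exists_disjoint_conjugates hm hd.symm
  obtain ⟨N, hN⟩ := supp_finite_bound h
  have hn : Even (N + N) := ⟨N, rfl⟩
  obtain ⟨i, hi⟩ := hxn (N + N)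
  have hxi := hi i le_rfl
  obtain ⟨c, hc, hch⟩ := hx i
  -- The factor `k` may be replaced by a conjugate supported beyond `2N`, with which the even
  -- element `θ` commutes.
  have e : f (h * k) = f (h * x i) := by
    rw [K1_mul_comm hK h, K1_mul_comm hK h, hc, K1_conj_mul hK hch]
  obtain ⟨z, hz, h₀, hh₀, rfl⟩ :=
    exists_mul_below_of_supp (hN.trans (Set.Iio_subset_Iio (by omega : N ≤ N + N)))
  rw [map_mul, parity_of_mem_zSubgroup hm hz, one_mul] at hs
  set θ := etaProd m (N + N)
  have hθ : z * h₀ * θ = zc m 1 * (θ * (z * h₀)) := by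
    have hzc := Subgroup.mem_center_iff.mp (zSubgroup_le_center m hz)
    rw [mul_assoc, below_etaProd hm hn hh₀, hs, ← mul_assoc θ, hzc θ]
    simp only [signExp, and_self, if_true, pow_one]
    rw [← mul_assoc, ← hzc (zc m 1)]
    simp only [mul_assoc]
    rfl
  have hθx : θ * x i = x i * θ := by
    have := parityCommute_of_below hm (etaProd_mem_below (m := m) (N + N)) hxi
    rw [ParityCommute, parity_etaProd, hn.neg_one_pow] at this
    change _ = ((eps m 1 _ : Subgroup.center (GInf' m)) : GInf' m) * _ at this
    rwa [eps_one_left, Subgroup.coe_one, one_mul] at this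
  have hz1 := hβ 0 1 0 (z * h₀ * x i)
  simp only [pow_zero, pow_one, one_mul, mul_one, hβ1, Units.val_neg, Units.val_one, Int.cast_neg,
    Int.cast_one, neg_mul] at hz1
  rw [e, ← self_eq_neg, ← hz1, ← hK.2.1 (zc m 1 * _) θ]
  congr 1
  rw [eq_mul_inv_iff_mul_eq, mul_assoc _ (x i), ← hθx, ← mul_assoc, hθ,
    ← mul_assoc θ (zc m 1), ← (zc_comm m 1 θ).eq]
  simp only [mul_assoc]

/-- Factorisability applied to two disjoint conjugates is exactly what the criterion by conjugates
asks for. -/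
theorem mem_E_of_mem_F (hm : Even m) {f : GInf' m → ℂ} (hf : f ∈ F m) : f ∈ E (GInf' m) := by
  refine mem_E_of_conjugates hf.1 fun h => ?_
  obtain ⟨x, hx, hxd, -⟩ := exists_disjoint_conjugates hm
    (h := h) (k := 1) (by rw [supp_one]; exact Set.disjoint_empty _)
  refine ⟨x, fun i => (hx i).imp fun c hc => hc.1, fun i j hij => ?_⟩
  have hval : ∀ i, f (x i) = f h := fun i => by
    obtain ⟨c, hc, -⟩ := hx i
    rw [hc, hf.1.2.1]
  rw [hf.2 _ _ (by rw [supp_inv]; exact hxd i j hij), hf.1.1.map_inv, hval, hval]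

theorem mul_mem_F {f₁ f₂ : GInf' m → ℂ} (h₁ : f₁ ∈ F m) (h₂ : f₂ ∈ F m) : f₁ * f₂ ∈ F m := by
  refine ⟨K1_mul h₁.1 h₂.1, fun h k hd => ?_⟩
  simp only [Pi.mul_apply, h₁.2 h k hd, h₂.2 h k hd]
  ring

theorem HasSpinType.mul {f₁ f₂ : GInf' m → ℂ} {β₁ β₂ : Fin 3 → ℤˣ} (h₁ : HasSpinType f₁ β₁)
    (h₂ : HasSpinType f₂ β₂) : HasSpinType (f₁ * f₂) (β₁ * β₂) := by
  intro a b c g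
  simp only [Pi.mul_apply, h₁ a b c g, h₂ a b c g, mul_pow, Units.val_mul, Int.cast_mul]
  ring

/-- A finite check on the sign bicharacter. It fails for the second kind: in type II, for instance,
the parity `(-1, -1)` commutes with itself, is not central, and has component product `1`. -/
theorem SpinType.FirstKind.parity_cases {Y : SpinType} (hY : Y.FirstKind) (p : ℤˣ × ℤˣ) :
    (∀ q, spinSign Y.chi p q = 1) ∨ spinSign Y.chi p p = -1 ∨
      (Y.chi 1 = -1 ∧ p.1 * p.2 = -1) := by
  revert p
  cases Y <;> first | exact hY.elim | decide

theorem SpinType.parity_cases {Y : SpinType} (hY : Y = .V ∨ Y = .VI) (p : ℤˣ × ℤˣ) :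
    p = 1 ∨ spinSign Y.chi p p = -1 ∨ (Y.chi 1 = -1 ∧ p.1 * p.2 = -1) := by
  revert p
  rcases hY with rfl | rfl <;> decide

theorem factorisable_of_firstKind (hm : Even m) {Y : SpinType} (hY : Y.FirstKind)
    {f : GInf' m → ℂ} (hf : f ∈ ESpin m Y) : f ∈ F m := by
  have hK : f ∈ K1 (GInf' m) := extremePoints_subset hf.1
  refine ⟨hK, fun h k hd => ?_⟩
  have hd1 : Disjoint (supp h) (supp (1 : GInf' m)) := by
    rw [supp_one]; exact Set.disjoint_empty _
  rcases hY.parity_cases (parity hm h) with hs | hs | ⟨hβ, hs⟩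
  · exact map_mul_of_central_parity hm hf.1 hf.2 hs hd
  · have h1 := map_mul_eq_zero_of_anticommute hm hK hf.2 hs hd1
    rw [mul_one] at h1
    rw [map_mul_eq_zero_of_anticommute hm hK hf.2 hs hd, h1, zero_mul]
  · have h1 := map_mul_eq_zero_of_odd hm hK hf.2 hβ hs hd1
    rw [mul_one] at h1
    rw [map_mul_eq_zero_of_odd hm hK hf.2 hβ hs hd, h1, zero_mul]

/-- Functions of spin type V or VI vanish on `h k` if `h` is not even and the supports are
disjoint. -/
theorem map_mul_eq_zero_of_V_or_VI (hm : Even m) {Y : SpinType} (hY : Y = .V ∨ Y = .VI)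
    {f : GInf' m → ℂ} (hK : f ∈ K1 (GInf' m)) (hβ : HasSpinType f Y.chi) {h k : GInf' m}
    (hp : parity hm h ≠ 1) (hd : Disjoint (supp h) (supp k)) : f (h * k) = 0 := by
  rcases SpinType.parity_cases hY (parity hm h) with hs | hs | ⟨h1, hs⟩
  · exact absurd hs hp
  · exact map_mul_eq_zero_of_anticommute hm hK hβ hs hd
  · exact map_mul_eq_zero_of_odd hm hK hβ h1 hs hd

theorem spinSign_one_left (β : Fin 3 → ℤˣ) (q : ℤˣ × ℤˣ) : spinSign β 1 q = 1 := by
  have h : (1 : ℤˣ) ≠ -1 := by decide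
  simp [spinSign, signExp, h]

theorem mul_mem_F_of_V_or_VI (hm : Even m) {Y₁ Y₂ Y₃ : SpinType} (h₃ : Y₃.chi = Y₁.chi * Y₂.chi)
    (hY : (Y₁ = .V ∨ Y₁ = .VI) ∨ (Y₂ = .V ∨ Y₂ = .VI) ∨ (Y₃ = .V ∨ Y₃ = .VI))
    {f₁ f₂ : GInf' m → ℂ} (hf₁ : f₁ ∈ ESpin m Y₁) (hf₂ : f₂ ∈ ESpin m Y₂) : f₁ * f₂ ∈ F m := by
  have hK₁ : f₁ ∈ K1 (GInf' m) := extremePoints_subset hf₁.1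
  have hK₂ : f₂ ∈ K1 (GInf' m) := extremePoints_subset hf₂.1
  have hK := K1_mul hK₁ hK₂
  have hβ : HasSpinType (f₁ * f₂) Y₃.chi := h₃ ▸ hf₁.2.mul hf₂.2
  refine ⟨hK, fun h k hd => ?_⟩
  by_cases hp : parity hm h = 1
  · simp only [Pi.mul_apply]
    rw [map_mul_of_central_parity hm hf₁.1 hf₁.2 (by simp [hp, spinSign_one_left]) hd,
      map_mul_of_central_parity hm hf₂.1 hf₂.2 (by simp [hp, spinSign_one_left]) hd]
    ring
  -- Vanishing is needed also at `k = 1`, so that both sides of the factorisation are zero.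
  · have vanish : ∀ k, Disjoint (supp h) (supp k) → (f₁ * f₂) (h * k) = 0 := by
      intro k hd
      rcases hY with hY | hY | hY
      · simp [map_mul_eq_zero_of_V_or_VI hm hY hK₁ hf₁.2 hp hd]
      · simp [map_mul_eq_zero_of_V_or_VI hm hY hK₂ hf₂.2 hp hd]
      -- Vanishing needs only membership in `K1`, so it applies to the product before its
      -- extremality is known.
      · exact map_mul_eq_zero_of_V_or_VI hm hY hK hβ hp hd
    have h1 := vanish 1 (by rw [supp_one]; exact Set.disjoint_empty _)
    rw [mul_one] at h1
    rw [vanish k hd, h1, zero_mul]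

end Spin

end SpinChar

theorem theorem12p8 (m : ℕ) (hpos : 0 < m) (heven : Even m) :
    (∀ f₁ ∈ SpinChar.F m, ∀ f₂ ∈ SpinChar.F m,
      f₁ * f₂ ∈ SpinChar.E (SpinChar.GInf' m) ∧ f₁ * f₂ ∈ SpinChar.F m) ∧
    (∀ Y₁ Y₂ Y₃ : SpinChar.SpinType, Y₃.chi = Y₁.chi * Y₂.chi →
      (∀ f₁ ∈ SpinChar.FSpin m Y₁, ∀ f₂ ∈ SpinChar.FSpin m Y₂,
        f₁ * f₂ ∈ SpinChar.FSpin m Y₃) ∧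
      (Y₁.FirstKind → Y₂.FirstKind →
        ∀ f₁ ∈ SpinChar.ESpin m Y₁, ∀ f₂ ∈ SpinChar.ESpin m Y₂,
          f₁ * f₂ ∈ SpinChar.ESpin m Y₃) ∧
      (((Y₁ = .V ∨ Y₁ = .VI) ∨ (Y₂ = .V ∨ Y₂ = .VI) ∨ (Y₃ = .V ∨ Y₃ = .VI)) →
        ∀ f₁ ∈ SpinChar.ESpin m Y₁, ∀ f₂ ∈ SpinChar.ESpin m Y₂,
          f₁ * f₂ ∈ SpinChar.ESpin m Y₃)) := by

  refine ⟨fun f₁ h₁ f₂ h₂ => ?_, fun Y₁ Y₂ Y₃ hY => ⟨fun f₁ h₁ f₂ h₂ => ?_,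
    fun k₁ k₂ f₁ h₁ f₂ h₂ => ?_, fun hV f₁ h₁ f₂ h₂ => ?_⟩⟩
  · have h := SpinChar.mul_mem_F h₁ h₂
    exact ⟨SpinChar.mem_E_of_mem_F heven h, h⟩
  · exact ⟨SpinChar.mul_mem_F h₁.1 h₂.1, hY ▸ h₁.2.mul h₂.2⟩
  · exact ⟨SpinChar.mem_E_of_mem_F heven (SpinChar.mul_mem_F
      (SpinChar.factorisable_of_firstKind heven k₁ h₁)
      (SpinChar.factorisable_of_firstKind heven k₂ h₂)), hY ▸ h₁.2.mul h₂.2⟩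
  · exact ⟨SpinChar.mem_E_of_mem_F heven (SpinChar.mul_mem_F_of_V_or_VI heven hY hV h₁ h₂),
      hY ▸ h₁.2.mul h₂.2⟩
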